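/- Let $T\in(0,+\infty]$; write $[0,T]$ for $\{t\ge 0 : t\le T\}$ (so $[0,\infty)$ if $T=+\infty$). Let $\Omega\subset\mathbb{R}^2$ be a non-empty, connected open set which has a regular boundary, i.e. $\partial\Omega\neq\emptyset$ is a $\mathcal{C}^1$ (embedded) submanifold of codimension $1$; $n(x)$ denotes a unit normal vector to $\partial\Omega$ at $x\in\partial\Omega$. A local Maxwellian on $[0,T]\times\Omega\times\mathbb{R}^2$ is a function $$m(t,x,v)=\rho(t,x)\exp\left(-a(t,x)\,|v-u(t,x)|^2\right)$$ with $\rho,a:[0,T]\times\Omega\to[0,\infty)$ positive almost everywhere, $u:[0,T]\times\Omega\to\mathbb{R}^2$, where $\rho,a,u$ are differentiable and $u$ is twice differentiable in $x$. Let $m:[0,T]\times\overline\Omega\times\mathbb{R}^2\to\mathbb{R}$ be continuous. We say that $m$ is admissible if it is a local Maxwellian on $[0,T]\times\Omega\times\mathbb{R}^2$, solves the free transport equation $\partial_t m+v\cdot\nabla_x m=0$ on $]0,T[\times\Omega\times\mathbb{R}^2$, and satisfies the specular reflection boundary condition $$m(t,x,v)=m\big(t,x,v-2(v\cdot n(x))n(x)\big)\qquad\forall\,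 t\in[0,T],\ x\in\partial\Omega,\ v\in\mathbb{R}^2 .$$ Then: <ul> <li>If $\Omega$ is a half-plane with $\partial\Omega=\{x_0n+\lambda\tau : \lambda\in\mathbb{R}\}$, where $x_0\in\mathbb{R}$ and $n,\tau$ are orthogonal unit vectors, then $m$ is admissible if and only if there exist $r_0>0$, $\alpha,\beta\in\mathbb{R}$, $\gamma>0$ and $\ell_1,\ell_2\in\mathbb{R}$, with $\alpha t^2+\beta t+\gamma>0$ for all $t\in[0,T]$, such that $$m(t,x,v)=r_0\exp\Big(-\alpha(x-tv-2x_0n)\cdot(x-tv)+\beta(x-tv-x_0n)\cdot v-\gamma|v|^2-2\ell_1\tau\cdot(x-tv)+2\ell_2\tau\cdot v\Big).$$</li> <li>If $\Omega$ is a slab (the open region between two distinct parallel lines) with $\partial\Omega=\{x_1n+\lambda\tau : \lambda\in\mathbb{R}\}\cup\{x_2n+\mu\tau : \mu\in\mathbb{R}\}$, where $x_1,x_2\in\mathbb{R}$ and $n,\tau$ are orthogonal unit vectors, then $m$ is admissible if and only if there exist $r_0>0$, $\gamma>0$ and $\ell_1,\ell_2\in\mathbb{R}$ such that $$m(t,x,v)=r_0\exp\Big(-\gamma|v|^2-2\ell_1\tau\cdot(x-tv)+2\ell_2\tau\cdot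 v\Big).$$</li> <li>If $\Omega$ is a disk centered on $y\in\mathbb{R}^2$, or the complement of a (closed) disk centered on $y$, or an annulus contained between two distinct concentric circles centered on $y$, then $m$ is admissible if and only if there exist $r_0>0$, $\gamma>0$ and a skew-symmetric $2\times2$ real matrix $\Lambda_0$ such that $$m(t,x,v)=r_0\exp\Big(-\gamma|v|^2+2[\Lambda_0(x-y)]\cdot v\Big).$$</li> <li>If $\Omega$ is not a half-plane, nor a slab, nor a disk, nor the complement of a disk, nor an annulus contained between two concentric circles, then $m$ is admissible if and only if there exist $r_0>0$ and $\gamma>0$ such that $$m(t,x,v)=r_0\exp\big(-\gamma|v|^2\big).$$</li> </ul> In each case the formula for $m$ is to hold for all $t\in[0,T]$, $x\in\overline\Omega$, $v\in\mathbb{R}^2$. -/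

import Mathlib

open Set Filter Topology MeasureTheory

/-- The Euclidean space `ℝ^d`. -/
abbrev Space (d : ℕ) : Type := EuclideanSpace ℝ (Fin d)

/-- The time interval `[0, T]`, which is `[0, ∞)` when `T = +∞`. -/
def timeInterval (T : EReal) : Set ℝ := {t | 0 ≤ t ∧ (t : EReal) ≤ T}

/-- The open time interval `]0, T[`. -/
def openTimeInterval (T : EReal) : Set ℝ := {t | 0 < t ∧ (t : EReal) < T}

/-! ### Regular domains and their normal vectors -/

/-- `g` is a local `C¹` equation, with non-zero gradient, of the boundary of `Ω` near the point
`x`. -/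
def IsLocalBoundaryEquation {d : ℕ} (Ω : Set (Space d)) (x : Space d) (g : Space d → ℝ) : Prop :=
  ContDiffAt ℝ 1 g x ∧ gradient g x ≠ 0 ∧ ∀ᶠ y in 𝓝 x, (y ∈ frontier Ω ↔ g y = 0)

/-- `Ω` has a boundary: `∂Ω` is non-empty, and it is a `C¹` (embedded) manifold of
codimension `1`. -/
def HasRegularBoundary {d : ℕ} (Ω : Set (Space d)) : Prop :=
  (frontier Ω).Nonempty ∧
    ∀ x ∈ frontier Ω, ∃ g : Space d → ℝ, IsLocalBoundaryEquation Ω x g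

/-- `n` is a unit normal vector to `∂Ω` at `x`: it has norm one, and it is collinear to the
gradient at `x` of a local equation of `∂Ω`. -/
def IsUnitNormal {d : ℕ} (Ω : Set (Space d)) (x n : Space d) : Prop :=
  ‖n‖ = 1 ∧ ∃ g : Space d → ℝ, IsLocalBoundaryEquation Ω x g ∧ ∃ c : ℝ, gradient g x = c • n

/-! ### Local Maxwellians, free transport, specular reflection -/

/-- `m` is a local Maxwellian on `[0, T] × Ω × ℝ^d`:
`m(t,x,v) = ρ(t,x) exp(-a(t,x) |v - u(t,x)|²)`, with `ρ`, `a` non-negative and positive almost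
everywhere, `ρ`, `a`, `u` differentiable in `(t, x)`, and `u` twice differentiable in `x`. -/
def IsLocalMaxwellian {d : ℕ} (T : EReal) (Ω : Set (Space d))
    (m : ℝ → Space d → Space d → ℝ) : Prop :=
  ∃ (ρ a : ℝ → Space d → ℝ) (u : ℝ → Space d → Space d),
    (∀ t ∈ timeInterval T, ∀ x ∈ Ω, 0 ≤ ρ t x ∧ 0 ≤ a t x) ∧
    (∀ᵐ p : ℝ × Space d, p ∈ timeInterval T ×ˢ Ω → 0 < ρ p.1 p.2 ∧ 0 < a p.1 p.2) ∧
    DifferentiableOn ℝ (fun p : ℝ × Space d => ρ p.1 p.2) (timeInterval T ×ˢ Ω) ∧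
    DifferentiableOn ℝ (fun p : ℝ × Space d => a p.1 p.2) (timeInterval T ×ˢ Ω) ∧
    DifferentiableOn ℝ (fun p : ℝ × Space d => u p.1 p.2) (timeInterval T ×ˢ Ω) ∧
    (∀ t ∈ timeInterval T, DifferentiableOn ℝ (fderiv ℝ (u t)) Ω) ∧
    ∀ t ∈ timeInterval T, ∀ x ∈ Ω, ∀ v : Space d,
      m t x v = ρ t x * Real.exp (-(a t x * ‖v - u t x‖ ^ 2))

/-- `m` solves the free transport equation `∂ₜ m + v · ∇ₓ m = 0` on `]0, T[ × Ω × ℝ^d`. -/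
def SolvesFreeTransport {d : ℕ} (T : EReal) (Ω : Set (Space d))
    (m : ℝ → Space d → Space d → ℝ) : Prop :=
  ∀ t ∈ openTimeInterval T, ∀ x ∈ Ω, ∀ v : Space d,
    DifferentiableAt ℝ (fun p : ℝ × Space d => m p.1 p.2 v) (t, x) ∧
    deriv (fun s => m s x v) t + inner ℝ v (gradient (fun y => m t y v) x) = 0

/-- The specular reflection boundary condition: `m(t,x,v) = m(t,x,v - 2 (v · n(x)) n(x))` for
all `t ∈ [0, T]`, `x ∈ ∂Ω`, `v ∈ ℝ^d`, with `n(x)` a unit normal vector to `∂Ω` at `x`. -/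
def SatisfiesSRBC {d : ℕ} (T : EReal) (Ω : Set (Space d))
    (m : ℝ → Space d → Space d → ℝ) : Prop :=
  ∀ t ∈ timeInterval T, ∀ x ∈ frontier Ω, ∀ n : Space d, IsUnitNormal Ω x n →
    ∀ v : Space d, m t x v = m t x (v - (2 * inner ℝ v n) • n)

/-- `m` is a local Maxwellian on `[0, T] × Ω × ℝ^d`, continuous up to the boundary of `Ω` (so
that its boundary values are those of the function inside the domain), that solves the free
transport equation with the specular reflection boundary condition. -/
def IsSpecularMaxwellian {d : ℕ} (T : EReal) (Ω : Set (Space d))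
    (m : ℝ → Space d → Space d → ℝ) : Prop :=
  IsLocalMaxwellian T Ω m ∧
  ContinuousOn (fun p : ℝ × Space d × Space d => m p.1 p.2.1 p.2.2)
    (timeInterval T ×ˢ (closure Ω ×ˢ univ)) ∧
  SolvesFreeTransport T Ω m ∧
  SatisfiesSRBC T Ω m

/-! ### The special domains of the plane -/

/-- The straight line `{c n + l τ | l ∈ ℝ}`. -/
def lineAt (c : ℝ) (n τ : Space 2) : Set (Space 2) := {x | ∃ l : ℝ, x = c • n + l • τ}

/-- `Ω` is an open half-plane. -/
def IsHalfPlane (Ω : Set (Space 2)) : Prop :=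
  ∃ (n : Space 2) (c : ℝ), ‖n‖ = 1 ∧ Ω = {x | c < inner ℝ n x}

/-- `Ω` is a slab: the open region between two distinct parallel lines. -/
def IsSlab (Ω : Set (Space 2)) : Prop :=
  ∃ (n : Space 2) (c₁ c₂ : ℝ), ‖n‖ = 1 ∧ c₁ < c₂ ∧ Ω = {x | c₁ < inner ℝ n x ∧ inner ℝ n x < c₂}

/-- `Ω` is an open disk centered on `y`. -/
def IsDisk (Ω : Set (Space 2)) (y : Space 2) : Prop :=
  ∃ r : ℝ, 0 < r ∧ Ω = {x | dist x y < r}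

/-- `Ω` is the (open) complement of a disk centered on `y`. -/
def IsDiskComplement (Ω : Set (Space 2)) (y : Space 2) : Prop :=
  ∃ r : ℝ, 0 < r ∧ Ω = {x | r < dist x y}

/-- `Ω` is the open annulus contained between two distinct concentric circles centered on `y`. -/
def IsAnnulus (Ω : Set (Space 2)) (y : Space 2) : Prop :=
  ∃ r₁ r₂ : ℝ, 0 < r₁ ∧ r₁ < r₂ ∧ Ω = {x | r₁ < dist x y ∧ dist x y < r₂}

/-!
The logarithm of a local Maxwellian is a polynomial `-a |v|² + 2 b · v + c` of degree two in `v`,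
with coefficients depending on `(t, x)`. Free transport, split into powers of `v`
(`transport_coeff`), says that `a` depends on `t` only, that the symmetric part of the derivative
of `b` in `x` is `a' / 2` times the identity, that `2 ∂ₜ b + ∇ c = 0`, and that `c` depends on `x`
only. The symmetry of second derivatives then makes `b` affine in `x` at each time and `∂ₜ b` free
of rotational part, so that
`a = α t² + β t + γ` and `b = (α x + q) t + (β / 2) x + w J x + p`, with `J` the quarter turn
(`exists_eqOn_conformalField`, `exists_coeff_of_transport`). Taking the logarithm is allowed because
a zero of the density would spread along the characteristics to an open set (`density_pos`), and
`a` is positive on the whole time interval because `u = b / a` would blow up otherwise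
(`inverseTemperature_pos`). By continuity the formula holds up to the boundary.

Specular reflection says that `b` is tangent to the boundary at all times, that is, that the two
affine fields `α x + q` and `(β / 2) x + w J x + p` are. Hence the problem is equivalent to
finding the conformal affine fields tangent to the boundary of the domain
(`exists_freeExponent`, `isSpecularMaxwellian_of_freeExponent`).

For lines and circles this is a computation. For the other domains, one shows that there is no
nonzero such field (`special_domain_of_isTangentField`). The boundary is only `C¹`, but it is still
invariant under the flow of a tangent field: the closest boundary points are reached along normal
directions, so that Grönwall's inequality applies to the square of the distance to the boundary
(`IsTangentField.integralCurve_mem`). If the field is a translation, the boundary is a union of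
parallel lines. If it is a rotation, the boundary is a union of circles, without their center,
because small circles around a boundary point cannot be contained in a regular boundary. Otherwise
the orbits are rays or logarithmic spirals converging to the zero of the field, which is then a
boundary point; the existence of a tangent line there excludes spirals and leaves a straight
line. Finally, a connected open set whose boundary is a union of parallel lines, or of concentric
circles, is a half-plane or a slab, or else a disk, the complement of a disk or an annulus.
-/

/-! ### Conformal affine fields of the plane and exponents transported freely -/

/-- The rotation of the plane by a quarter turn, `(x₀, x₁) ↦ (-x₁, x₀)`. -/
noncomputable def quarterTurn : Space 2 →L[ℝ] Space 2 :=
  LinearMap.toContinuousLinearMap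
    { toFun := fun x => !₂[-x 1, x 0]
      map_add' := fun x y => by ext i; fin_cases i <;> simp [add_comm]
      map_smul' := fun c x => by ext i; fin_cases i <;> simp }

@[simp] lemma quarterTurn_zero_coord (x : Space 2) : quarterTurn x 0 = -x 1 := rfl

@[simp] lemma quarterTurn_one_coord (x : Space 2) : quarterTurn x 1 = x 0 := rfl

lemma inner_eq_coord (x y : Space 2) : inner ℝ x y = x 0 * y 0 + x 1 * y 1 := by
  simp [PiLp.inner_apply, Fin.sum_univ_two, mul_comm]

lemma norm_sq_eq_coord (x : Space 2) : ‖x‖ ^ 2 = x 0 ^ 2 + x 1 ^ 2 := by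
  simp [EuclideanSpace.norm_sq_eq, Fin.sum_univ_two]

/-- The affine vector field `x ↦ l x + w J x + p`, where `J` is the quarter turn. -/
noncomputable def conformalField (l w : ℝ) (p x : Space 2) : Space 2 :=
  l • x + w • quarterTurn x + p

/-- The vector field `V` is tangent to the boundary of `Ω`. -/
def IsTangentField (Ω : Set (Space 2)) (V : Space 2 → Space 2) : Prop :=
  ∀ x ∈ frontier Ω, ∀ n, IsUnitNormal Ω x n → inner ℝ n (V x) = 0

/-- The logarithm of the most general local Maxwellian of the plane carried by free transport,
as a function of `y = x - t v` and of `v`, both of which are constant along the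
characteristics. -/
noncomputable def freeExponent (c α β γ w : ℝ) (p q y v : Space 2) : ℝ :=
  c - α * ‖y‖ ^ 2 + β * inner ℝ y v - γ * ‖v‖ ^ 2 + 2 * w * inner ℝ (quarterTurn y) v
    - 2 * inner ℝ q y + 2 * inner ℝ p v

/-- The expansion in powers of `v` of the exponent of a transported Maxwellian. -/
lemma freeExponent_sub_smul (c α β γ w : ℝ) (p q x v : Space 2) (t : ℝ) :
    freeExponent c α β γ w p q (x - t • v) v =
      -((α * t ^ 2 + β * t + γ) * ‖v‖ ^ 2)
        + 2 * inner ℝ (conformalField (α * t + β / 2) w (t • q + p) x) v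
        + (c - α * ‖x‖ ^ 2 - 2 * inner ℝ q x) := by
  simp only [freeExponent, conformalField, inner_eq_coord, norm_sq_eq_coord, PiLp.sub_apply,
    PiLp.smul_apply, PiLp.add_apply, quarterTurn_zero_coord, quarterTurn_one_coord, smul_eq_mul]
  ring

lemma contDiff_freeExponent (c α β γ w : ℝ) (p q v : Space 2) :
    ContDiff ℝ 1 (fun y => freeExponent c α β γ w p q y v) := by
  unfold freeExponent
  have h1 : ContDiff ℝ 1 (fun y : Space 2 => ‖y‖ ^ 2) := contDiff_norm_sq ℝ
  have h2 : ContDiff ℝ 1 (fun y : Space 2 => inner ℝ y v) := contDiff_id.inner ℝ contDiff_const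
  have h3 : ContDiff ℝ 1 (fun y : Space 2 => inner ℝ (quarterTurn y) v) :=
    quarterTurn.contDiff.inner ℝ contDiff_const
  have h4 : ContDiff ℝ 1 (fun y : Space 2 => inner ℝ q y) := contDiff_const.inner ℝ contDiff_id
  exact ((((((contDiff_const.sub (contDiff_const.mul h1)).add (contDiff_const.mul h2)).sub
    contDiff_const).add (contDiff_const.mul h3)).sub (contDiff_const.mul h4)).add contDiff_const)

lemma continuous_freeExponent (c α β γ w : ℝ) (p q : Space 2) :
    Continuous (fun y : Space 2 × Space 2 => freeExponent c α β γ w p q y.1 y.2) := by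
  unfold freeExponent
  fun_prop

/-! ### Maxwellians with a freely transported exponent -/

lemma isOpen_openTimeInterval (T : EReal) : IsOpen (openTimeInterval T) :=
  (isOpen_lt continuous_const continuous_id).inter
    (isOpen_lt continuous_coe_real_ereal continuous_const)

lemma openTimeInterval_subset (T : EReal) : openTimeInterval T ⊆ timeInterval T :=
  fun _ ht => ⟨ht.1.le, ht.2.le⟩

lemma zero_mem_timeInterval {T : EReal} (hT : 0 < T) : (0 : ℝ) ∈ timeInterval T :=
  ⟨le_rfl, by simpa using hT.le⟩

lemma reflect_norm_sq {d : ℕ} {n : Space d} (hn : ‖n‖ = 1) (v : Space d) :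
    ‖v - (2 * inner ℝ v n) • n‖ ^ 2 = ‖v‖ ^ 2 := by
  rw [norm_sub_sq_real, inner_smul_right, norm_smul, mul_pow, hn, Real.norm_eq_abs, sq_abs]
  ring

/-- Completing the square in `v` exhibits the density, temperature and velocity fields. -/
lemma isLocalMaxwellian_of_freeExponent {T : EReal} {Ω : Set (Space 2)}
    {m : ℝ → Space 2 → Space 2 → ℝ} {c α β γ w : ℝ} {p q : Space 2}
    (hpos : ∀ t ∈ timeInterval T, 0 < α * t ^ 2 + β * t + γ)
    (hm : ∀ t ∈ timeInterval T, ∀ x ∈ Ω, ∀ v,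
      m t x v = Real.exp (freeExponent c α β γ w p q (x - t • v) v)) :
    IsLocalMaxwellian T Ω m := by
  set A : ℝ → ℝ := fun t => α * t ^ 2 + β * t + γ with hA
  set u : ℝ → Space 2 → Space 2 :=
    fun t x => (A t)⁻¹ • conformalField (α * t + β / 2) w (t • q + p) x with hu
  have hA0 : ∀ z ∈ timeInterval T ×ˢ Ω, A z.1 ≠ 0 := fun z hz => (hpos z.1 hz.1).ne'
  have hAd : DifferentiableOn ℝ (fun z : ℝ × Space 2 => A z.1) (timeInterval T ×ˢ Ω) := by
    simp only [hA]; fun_prop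
  have hud : DifferentiableOn ℝ (fun z : ℝ × Space 2 => u z.1 z.2) (timeInterval T ×ˢ Ω) := by
    refine (hAd.inv hA0).smul ?_
    simp only [conformalField]; fun_prop
  refine ⟨fun t x => Real.exp (c - α * ‖x‖ ^ 2 - 2 * inner ℝ q x + A t * ‖u t x‖ ^ 2),
    fun t _ => A t, u, fun t ht x _ => ⟨(Real.exp_pos _).le, (hpos t ht).le⟩,
    Eventually.of_forall fun z hz => ⟨Real.exp_pos _, hpos z.1 hz.1⟩, ?_, hAd, hud, ?_, ?_⟩
  · have h1 : DifferentiableOn ℝ (fun z : ℝ × Space 2 => ‖u z.1 z.2‖ ^ 2)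
      (timeInterval T ×ˢ Ω) := hud.norm_sq ℝ
    have h2 : Differentiable ℝ (fun z : ℝ × Space 2 => ‖z.2‖ ^ 2) :=
      differentiable_snd.norm_sq ℝ
    have h3 : Differentiable ℝ (fun z : ℝ × Space 2 => inner ℝ q z.2) :=
      (differentiable_const q).inner ℝ differentiable_snd
    exact ((((h2.const_mul α).const_sub c).sub (h3.const_mul 2)).differentiableOn.add
      (hAd.mul h1)).exp
  · intro t _
    have h : ContDiff ℝ 2 (u t) := by
      simp only [hu, conformalField]; fun_prop
    exact ((h.fderiv_right (m := 1) (by norm_num)).differentiable (by norm_num)).differentiableOn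
  · intro t ht x hx v
    have hb : conformalField (α * t + β / 2) w (t • q + p) x = A t • u t x := by
      rw [hu, smul_smul, mul_inv_cancel₀ (hpos t ht).ne', one_smul]
    rw [hm t ht x hx v, freeExponent_sub_smul, ← Real.exp_add, hb, norm_sub_sq_real,
      inner_smul_left, real_inner_comm]
    congr 1
    simp only [hA, conj_trivial]
    ring

lemma solvesFreeTransport_of_freeExponent {T : EReal} {Ω : Set (Space 2)} (hΩ : IsOpen Ω)
    {m : ℝ → Space 2 → Space 2 → ℝ} {c α β γ w : ℝ} {p q : Space 2}
    (hm : ∀ t ∈ timeInterval T, ∀ x ∈ Ω, ∀ v,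
      m t x v = Real.exp (freeExponent c α β γ w p q (x - t • v) v)) :
    SolvesFreeTransport T Ω m := by
  intro t ht x hx v
  set F : Space 2 → ℝ := fun y => Real.exp (freeExponent c α β γ w p q y v) with hF
  have hFd : Differentiable ℝ F :=
    ((contDiff_freeExponent c α β γ w p q v).differentiable (by norm_num)).exp
  have hmem : openTimeInterval T ×ˢ Ω ∈ 𝓝 (t, x) :=
    ((isOpen_openTimeInterval T).prod hΩ).mem_nhds ⟨ht, hx⟩
  have hev : (fun z : ℝ × Space 2 => m z.1 z.2 v) =ᶠ[𝓝 (t, x)] fun z => F (z.2 - z.1 • v) := by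
    filter_upwards [hmem] with z hz
    exact hm z.1 (openTimeInterval_subset T hz.1) z.2 hz.2 v
  have h1 : (fun s => m s x v) =ᶠ[𝓝 t] fun s => F (x - s • v) := by
    filter_upwards [(isOpen_openTimeInterval T).mem_nhds ht] with s hs
    exact hm s (openTimeInterval_subset T hs) x hx v
  have h2 : (fun y => m t y v) =ᶠ[𝓝 x] fun y => F (y - t • v) := by
    filter_upwards [hΩ.mem_nhds hx] with y hy
    exact hm t (openTimeInterval_subset T ht) y hy v
  have d1 : HasDerivAt (fun s : ℝ => F (x - s • v)) (fderiv ℝ F (x - t • v) (-v)) t := by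
    have hl : HasDerivAt (fun s : ℝ => x - s • v) (-v) t := by
      simpa using ((hasDerivAt_id t).smul_const v).const_sub x
    exact (hFd (x - t • v)).hasFDerivAt.comp_hasDerivAt t hl
  have d2 : HasFDerivAt (fun y : Space 2 => F (y - t • v)) (fderiv ℝ F (x - t • v)) x := by
    have hl : HasFDerivAt (fun y : Space 2 => y - t • v) (ContinuousLinearMap.id ℝ _) x :=
      (hasFDerivAt_id x).sub_const _
    have h := (hFd (x - t • v)).hasFDerivAt.comp x hl
    rwa [ContinuousLinearMap.comp_id] at h
  refine ⟨?_, ?_⟩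
  · refine DifferentiableAt.congr_of_eventuallyEq ?_ hev
    have : Differentiable ℝ (fun z : ℝ × Space 2 => F (z.2 - z.1 • v)) :=
      hFd.comp (by fun_prop)
    exact this _
  · rw [h1.deriv_eq, d1.deriv, real_inner_comm, inner_gradient_left, h2.fderiv_eq, d2.fderiv]
    simp

/-- Tangency of the two fields that compose the momentum makes the exponent even in the normal
component of the velocity, which is specular reflection. -/
lemma isSpecularMaxwellian_of_freeExponent {T : EReal} {Ω : Set (Space 2)} (hΩ : IsOpen Ω)
    {m : ℝ → Space 2 → Space 2 → ℝ} {c α β γ w : ℝ} {p q : Space 2}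
    (hpos : ∀ t ∈ timeInterval T, 0 < α * t ^ 2 + β * t + γ)
    (hm : ∀ t ∈ timeInterval T, ∀ x ∈ closure Ω, ∀ v,
      m t x v = Real.exp (freeExponent c α β γ w p q (x - t • v) v))
    (hq : IsTangentField Ω (conformalField α 0 q))
    (hp : IsTangentField Ω (conformalField (β / 2) w p)) :
    IsSpecularMaxwellian T Ω m := by
  have hm' : ∀ t ∈ timeInterval T, ∀ x ∈ Ω, ∀ v,
      m t x v = Real.exp (freeExponent c α β γ w p q (x - t • v) v) :=
    fun t ht x hx => hm t ht x (subset_closure hx)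
  refine ⟨isLocalMaxwellian_of_freeExponent hpos hm', ?_,
    solvesFreeTransport_of_freeExponent hΩ hm', ?_⟩
  · refine ContinuousOn.congr (f := fun z : ℝ × Space 2 × Space 2 =>
      Real.exp (freeExponent c α β γ w p q (z.2.1 - z.1 • z.2.2) z.2.2)) ?_
      fun z hz => hm z.1 hz.1 z.2.1 hz.2.1 z.2.2
    refine (Real.continuous_exp.comp ?_).continuousOn
    exact (continuous_freeExponent c α β γ w p q).comp (f := fun z : ℝ × Space 2 × Space 2 =>
      (z.2.1 - z.1 • z.2.2, z.2.2)) (by fun_prop)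
  · intro t ht x hx n hn v
    have hxc := frontier_subset_closure hx
    have hb : inner ℝ (conformalField (α * t + β / 2) w (t • q + p) x) n = 0 := by
      have e : conformalField (α * t + β / 2) w (t • q + p) x =
          t • conformalField α 0 q x + conformalField (β / 2) w p x := by
        simp only [conformalField]; module
      rw [e, real_inner_comm, inner_add_right, inner_smul_right, hq x hx n hn, hp x hx n hn]
      simp
    rw [hm t ht x hxc, hm t ht x hxc, freeExponent_sub_smul, freeExponent_sub_smul,
      reflect_norm_sq hn.1, inner_sub_right _ v, inner_smul_right, hb, mul_zero, sub_zero]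

/-! ### Vector fields with conformal derivative -/

lemma clm_ext_coord {F : Type*} [NormedAddCommGroup F] [NormedSpace ℝ F]
    {L M : Space 2 →L[ℝ] F} (h0 : L (EuclideanSpace.single 0 1) = M (EuclideanSpace.single 0 1))
    (h1 : L (EuclideanSpace.single 1 1) = M (EuclideanSpace.single 1 1)) : L = M := by
  ext v
  have hv : v = v 0 • EuclideanSpace.single 0 (1 : ℝ) + v 1 • EuclideanSpace.single 1 (1 : ℝ) := by
    ext i; fin_cases i <;> simp
  rw [hv, map_add, map_add, map_smul, map_smul, map_smul, map_smul, h0, h1]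

/-- A linear map of the plane whose quadratic form is a multiple of the square of the norm is a
combination of the identity and of the quarter turn. -/
lemma eq_smul_id_add_smul_quarterTurn {L : Space 2 →L[ℝ] Space 2} {l : ℝ}
    (h : ∀ v, inner ℝ (L v) v = l * ‖v‖ ^ 2) :
    L = l • ContinuousLinearMap.id ℝ (Space 2)
      + (L (EuclideanSpace.single 0 1) 1) • quarterTurn := by
  set e0 : Space 2 := EuclideanSpace.single 0 1
  set e1 : Space 2 := EuclideanSpace.single 1 1
  have h0 := h e0
  have h1 := h e1
  have h2 := h (e0 + e1)
  rw [map_add] at h2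
  simp [inner_eq_coord, norm_sq_eq_coord, e0, e1] at h0 h1 h2
  apply clm_ext_coord
  · ext i; fin_cases i <;> simp [e0, h0]
  · ext i; fin_cases i <;> simp [e0, h1]
    linarith

lemma hasFDerivAt_conformalField (l w : ℝ) (p x : Space 2) :
    HasFDerivAt (conformalField l w p)
      (l • ContinuousLinearMap.id ℝ (Space 2) + w • quarterTurn) x := by
  have := (l • ContinuousLinearMap.id ℝ (Space 2) + w • quarterTurn).hasFDerivAt (x := x)
  exact this.add_const p

/-- A twice differentiable field of the plane whose derivative is everywhere the sum of the same
multiple of the identity and of a skew-symmetric map is affine: the symmetry of the second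
derivative prevents the skew-symmetric part from varying. -/
lemma exists_eqOn_conformalField {Ω : Set (Space 2)} (hΩ : IsOpen Ω) (hc : IsPreconnected Ω)
    {f : Space 2 → Space 2} (hf : DifferentiableOn ℝ f Ω)
    (hf' : DifferentiableOn ℝ (fderiv ℝ f) Ω) {l : ℝ}
    (h : ∀ x ∈ Ω, ∀ v, inner ℝ (fderiv ℝ f x v) v = l * ‖v‖ ^ 2) :
    ∃ (w : ℝ) (p : Space 2), EqOn f (conformalField l w p) Ω := by
  set e0 : Space 2 := EuclideanSpace.single 0 1 with he0
  set e1 : Space 2 := EuclideanSpace.single 1 1 with he1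
  set ω : Space 2 → ℝ := fun x => fderiv ℝ f x e0 1 with hω
  have hD : ∀ x ∈ Ω, fderiv ℝ f x =
      l • ContinuousLinearMap.id ℝ (Space 2) + ω x • quarterTurn :=
    fun x hx => eq_smul_id_add_smul_quarterTurn (h x hx)
  have hωd : DifferentiableOn ℝ ω Ω := by
    have h1 : DifferentiableOn ℝ (fun x => fderiv ℝ f x e0) Ω :=
      hf'.clm_apply (differentiableOn_const _)
    exact (differentiableOn_euclidean.1 h1) 1
  have hω0 : EqOn (fderiv ℝ ω) 0 Ω := by
    intro x hx
    have hωx := (hωd.differentiableAt (hΩ.mem_nhds hx)).hasFDerivAt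
    have hD' : HasFDerivAt (fderiv ℝ f) ((fderiv ℝ ω x).smulRight quarterTurn) x := by
      refine ((hωx.smul_const quarterTurn).const_add
        (l • ContinuousLinearMap.id ℝ (Space 2))).congr_of_eventuallyEq ?_
      filter_upwards [hΩ.mem_nhds hx] with y hy using hD y hy
    have hs := second_derivative_symmetric_of_eventually (f := f) (f' := fderiv ℝ f) (by
      filter_upwards [hΩ.mem_nhds hx] with y hy
      exact (hf.differentiableAt (hΩ.mem_nhds hy)).hasFDerivAt) hD' e0 e1
    have c0 := congrArg (fun z : Space 2 => z 0) hs
    have c1 := congrArg (fun z : Space 2 => z 1) hs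
    simp [he0, he1] at c0 c1
    exact clm_ext_coord (by simpa using c0) (by simpa using c1.symm)
  obtain ⟨w, hw⟩ := hΩ.exists_is_const_of_fderiv_eq_zero hc hωd hω0
  obtain ⟨p, hp⟩ := hΩ.exists_eq_add_of_fderiv_eq hc hf
    (g := conformalField l w 0)
    (fun x _ => (hasFDerivAt_conformalField l w 0 x).differentiableAt.differentiableWithinAt)
    (fun x hx => by rw [(hasFDerivAt_conformalField l w 0 x).fderiv, hD x hx, hw x hx])
  refine ⟨w, p, fun x hx => ?_⟩
  rw [hp hx]
  simp [conformalField]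

/-! ### Identification of the coefficients of polynomials in the velocity -/

lemma quadratic_coeff_unique {a a' c c' : ℝ} {b b' : Space 2}
    (h : ∀ v, -(a * ‖v‖ ^ 2) + 2 * inner ℝ b v + c = -(a' * ‖v‖ ^ 2) + 2 * inner ℝ b' v + c') :
    a = a' ∧ b = b' ∧ c = c' := by
  have h0 := h 0
  have h1 := h (EuclideanSpace.single 0 1)
  have h2 := h (EuclideanSpace.single 0 (-1))
  have h3 := h (EuclideanSpace.single 1 1)
  simp [inner_eq_coord] at h0 h1 h2 h3
  refine ⟨by linarith, ?_, h0⟩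
  ext i; fin_cases i
  · show b 0 = b' 0
    linarith
  · show b 1 = b' 1
    linarith

/-- The transport equation along the direction `(1, v)` of space-time, for an exponent that is a
polynomial of degree two in `v`, splits into one equation for each power of `v`. -/
lemma transport_coeff {a c : ℝ × Space 2 → ℝ} {b : ℝ × Space 2 → Space 2} {z : ℝ × Space 2}
    (ha : DifferentiableAt ℝ a z) (hb : DifferentiableAt ℝ b z) (hc : DifferentiableAt ℝ c z)
    (h : ∀ v : Space 2,
      fderiv ℝ (fun y => -(a y * ‖v‖ ^ 2) + 2 * inner ℝ (b y) v + c y) z (1, v) = 0) :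
    (∀ v, fderiv ℝ a z (0, v) = 0) ∧
    (∀ v, inner ℝ (fderiv ℝ b z (0, v)) v = fderiv ℝ a z (1, 0) / 2 * ‖v‖ ^ 2) ∧
    (∀ v, 2 * inner ℝ (fderiv ℝ b z (1, 0)) v + fderiv ℝ c z (0, v) = 0) ∧
    fderiv ℝ c z (1, 0) = 0 := by
  have key : ∀ (v : Space 2) (s : ℝ),
      -(s ^ 3 * (fderiv ℝ a z (0, v) * ‖v‖ ^ 2))
        + s ^ 2 * (2 * inner ℝ (fderiv ℝ b z (0, v)) v - fderiv ℝ a z (1, 0) * ‖v‖ ^ 2)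
        + s * (2 * inner ℝ (fderiv ℝ b z (1, 0)) v + fderiv ℝ c z (0, v))
        + fderiv ℝ c z (1, 0) = 0 := by
    intro v s
    have hv := h (s • v)
    have hd : HasFDerivAt (fun y => -(a y * ‖s • v‖ ^ 2) + 2 * inner ℝ (b y) (s • v) + c y)
        (-(‖s • v‖ ^ 2 • fderiv ℝ a z)
          + (2 : ℝ) • (innerSL ℝ (s • v)).comp (fderiv ℝ b z) + fderiv ℝ c z) z := by
      have h1 := (ha.hasFDerivAt.mul_const (‖s • v‖ ^ 2)).neg
      have h2 : HasFDerivAt (fun y => inner ℝ (b y) (s • v))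
          ((innerSL ℝ (s • v)).comp (fderiv ℝ b z)) z := by
        have := (innerSL ℝ (s • v)).hasFDerivAt.comp z hb.hasFDerivAt
        exact this.congr_of_eventuallyEq
          (Eventually.of_forall fun y => real_inner_comm (s • v) (b y))
      exact (h1.add (h2.const_mul 2)).add hc.hasFDerivAt
    have e : ((1 : ℝ), s • v) = (1, 0) + s • ((0 : ℝ), v) := by simp
    rw [hd.fderiv, e] at hv
    simp only [add_apply, neg_apply, smul_apply, ContinuousLinearMap.comp_apply, map_add,
      map_smul, innerSL_apply_apply, smul_eq_mul, norm_smul, mul_pow, Real.norm_eq_abs, sq_abs,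
      real_inner_comm v] at hv ⊢
    linarith
  have h0 : fderiv ℝ c z (1, 0) = 0 := by simpa using key 0 0
  have hk : ∀ v : Space 2, fderiv ℝ a z (0, v) * ‖v‖ ^ 2 = 0 ∧
      2 * inner ℝ (fderiv ℝ b z (0, v)) v - fderiv ℝ a z (1, 0) * ‖v‖ ^ 2 = 0 ∧
      2 * inner ℝ (fderiv ℝ b z (1, 0)) v + fderiv ℝ c z (0, v) = 0 := by
    intro v
    have k1 := key v 1
    have k2 := key v (-1)
    have k3 := key v 2
    rw [h0] at k1 k2 k3
    refine ⟨by linarith, by linarith, by linarith⟩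
  refine ⟨fun v => ?_, fun v => by linarith [(hk v).2.1], fun v => (hk v).2.2, h0⟩
  rcases eq_or_ne v 0 with rfl | hv
  · exact (fderiv ℝ a z).map_zero
  · exact (mul_eq_zero.1 (hk v).1).resolve_right (by simpa using hv)

/-! ### The general transported Maxwellian -/

/-- The coefficients `a`, `b`, `c` of an exponent that satisfy the equations of `transport_coeff`
on a product domain are, up to finitely many constants, explicit polynomials. -/
theorem exists_coeff_of_transport {I : Set ℝ} {Ω : Set (Space 2)} (hI : IsOpen I)
    (hIc : IsPreconnected I) (hIn : I.Nonempty) (hΩ : IsOpen Ω) (hΩc : IsConnected Ω)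
    {a c : ℝ × Space 2 → ℝ} {b : ℝ × Space 2 → Space 2}
    (ha : DifferentiableOn ℝ a (I ×ˢ Ω)) (hb : DifferentiableOn ℝ b (I ×ˢ Ω))
    (hc : DifferentiableOn ℝ c (I ×ˢ Ω))
    (hb2 : ∀ t ∈ I, DifferentiableOn ℝ (fderiv ℝ fun x => b (t, x)) Ω)
    (hax : ∀ z ∈ I ×ˢ Ω, ∀ v, fderiv ℝ a z (0, v) = 0)
    (hbx : ∀ z ∈ I ×ˢ Ω, ∀ v,
      inner ℝ (fderiv ℝ b z (0, v)) v = fderiv ℝ a z (1, 0) / 2 * ‖v‖ ^ 2)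
    (hbt : ∀ z ∈ I ×ˢ Ω, ∀ v, 2 * inner ℝ (fderiv ℝ b z (1, 0)) v + fderiv ℝ c z (0, v) = 0)
    (hct : ∀ z ∈ I ×ˢ Ω, fderiv ℝ c z (1, 0) = 0) :
    ∃ (c₀ α β γ w : ℝ) (p q : Space 2), ∀ t ∈ I, ∀ x ∈ Ω,
      a (t, x) = α * t ^ 2 + β * t + γ ∧
      b (t, x) = conformalField (α * t + β / 2) w (t • q + p) x ∧
      c (t, x) = c₀ - α * ‖x‖ ^ 2 - 2 * inner ℝ q x := by
  obtain ⟨x₀, hx₀⟩ := hΩc.nonempty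
  obtain ⟨t₁, ht₁⟩ := hIn
  obtain ⟨t₂, ht₂, ht12⟩ : ∃ t₂ ∈ I, t₂ ≠ t₁ := by
    have := (hI.mem_nhds ht₁)
    obtain ⟨ε, hε, hball⟩ := Metric.mem_nhds_iff.1 this
    refine ⟨t₁ + ε / 2, hball ?_, by simp [hε.ne']⟩
    simp [abs_of_pos hε, hε]
  have hopen : IsOpen (I ×ˢ Ω) := hI.prod hΩ
  have at_ : ∀ {F : Type} [NormedAddCommGroup F] [NormedSpace ℝ F] {f : ℝ × Space 2 → F},
      DifferentiableOn ℝ f (I ×ˢ Ω) → ∀ t ∈ I, ∀ x ∈ Ω,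
      HasFDerivAt f (fderiv ℝ f (t, x)) (t, x) := fun hf t ht x hx =>
    (hf.differentiableAt (hopen.mem_nhds ⟨ht, hx⟩)).hasFDerivAt
  -- partial derivatives in space and in time
  have dx : ∀ {F : Type} [NormedAddCommGroup F] [NormedSpace ℝ F] {f : ℝ × Space 2 → F},
      DifferentiableOn ℝ f (I ×ˢ Ω) → ∀ t ∈ I, ∀ x ∈ Ω, HasFDerivAt (fun y => f (t, y))
        ((fderiv ℝ f (t, x)).comp (ContinuousLinearMap.inr ℝ ℝ (Space 2))) x :=
    fun hf t ht x hx => (at_ hf t ht x hx).comp x (hasFDerivAt_prodMk_right t x)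
  have dt : ∀ {F : Type} [NormedAddCommGroup F] [NormedSpace ℝ F] {f : ℝ × Space 2 → F},
      DifferentiableOn ℝ f (I ×ˢ Ω) → ∀ t ∈ I, ∀ x ∈ Ω, HasDerivAt (fun s => f (s, x))
        (fderiv ℝ f (t, x) (1, 0)) t := fun hf t ht x hx => by
    exact (at_ hf t ht x hx).comp_hasDerivAt t
      ((hasDerivAt_id t).prodMk (hasDerivAt_const t x))
  -- `a` depends on `t` only and `c` on `x` only
  have haA : ∀ t ∈ I, ∀ x ∈ Ω, a (t, x) = a (t, x₀) := fun t ht x hx =>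
    hΩ.is_const_of_fderiv_eq_zero (f := fun y => a (t, y)) hΩc.isPreconnected
      (fun y hy => (dx ha t ht y hy).differentiableAt.differentiableWithinAt)
      (fun y hy => by
        rw [(dx ha t ht y hy).fderiv]
        ext v
        exact hax (t, y) ⟨ht, hy⟩ v) hx hx₀
  have hcC : ∀ t ∈ I, ∀ x ∈ Ω, c (t, x) = c (t₁, x) := fun t ht x hx =>
    hI.is_const_of_deriv_eq_zero (f := fun s => c (s, x)) hIc
      (fun s hs => (dt hc s hs x hx).differentiableAt.differentiableWithinAt)
      (fun s hs => by rw [(dt hc s hs x hx).deriv]; exact hct (s, x) ⟨hs, hx⟩) ht ht₁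
  have hat : ∀ t ∈ I, ∀ x ∈ Ω, fderiv ℝ a (t, x) (1, 0) = fderiv ℝ a (t, x₀) (1, 0) := by
    intro t ht x hx
    refine (dt ha t ht x hx).unique ((dt ha t ht x₀ hx₀).congr_of_eventuallyEq ?_)
    filter_upwards [hI.mem_nhds ht] with s hs using haA s hs x hx
  -- `b` is affine in `x` at each time
  have hbconf : ∀ t ∈ I, ∃ (w : ℝ) (p : Space 2), EqOn (fun x => b (t, x))
      (conformalField (fderiv ℝ a (t, x₀) (1, 0) / 2) w p) Ω := by
    intro t ht
    refine exists_eqOn_conformalField hΩ hΩc.isPreconnected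
      (fun x hx => (dx hb t ht x hx).differentiableAt.differentiableWithinAt) (hb2 t ht) ?_
    intro x hx v
    rw [(dx hb t ht x hx).fderiv, ← hat t ht x hx]
    exact hbx (t, x) ⟨ht, hx⟩ v
  obtain ⟨w₁, p₁, h₁⟩ := hbconf t₁ ht₁
  obtain ⟨w₂, p₂, h₂⟩ := hbconf t₂ ht₂
  -- the gradient of `c` does not depend on `t`, hence neither does the time derivative of `b`
  have hcx : ∀ t ∈ I, ∀ x ∈ Ω, ∀ v, fderiv ℝ c (t, x) (0, v) = fderiv ℝ c (t₁, x) (0, v) := by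
    intro t ht x hx v
    have := (dx hc t ht x hx).unique ((dx hc t₁ ht₁ x hx).congr_of_eventuallyEq (by
      filter_upwards [hΩ.mem_nhds hx] with y hy using hcC t ht y hy))
    simpa using DFunLike.congr_fun this v
  have hbtc : ∀ t ∈ I, ∀ x ∈ Ω, fderiv ℝ b (t, x) (1, 0) = fderiv ℝ b (t₁, x) (1, 0) := by
    intro t ht x hx
    refine ext_inner_right ℝ fun v => ?_
    have e1 := hbt (t, x) ⟨ht, hx⟩ v
    have e2 := hbt (t₁, x) ⟨ht₁, hx⟩ v
    rw [hcx t ht x hx] at e1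
    linarith
  set g : Space 2 → Space 2 := fun x => fderiv ℝ b (t₁, x) (1, 0) with hg
  have hbaff : ∀ t ∈ I, ∀ x ∈ Ω, b (t, x) = b (t₁, x) + (t - t₁) • g x := by
    intro t ht x hx
    have hd : ∀ s ∈ I, HasDerivAt (fun s => b (s, x) - (s - t₁) • g x) 0 s := by
      intro s hs
      have := (dt hb s hs x hx).sub (((hasDerivAt_id s).sub_const t₁).smul_const (g x))
      rw [hbtc s hs x hx, one_smul, sub_self] at this
      exact this
    have := hI.is_const_of_deriv_eq_zero (f := fun s => b (s, x) - (s - t₁) • g x) hIc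
      (fun s hs => (hd s hs).differentiableAt.differentiableWithinAt)
      (fun s hs => (hd s hs).deriv) ht ht₁
    simp only [sub_self, zero_smul, sub_zero] at this
    rw [← this]; abel
  have h21 : t₂ - t₁ ≠ 0 := sub_ne_zero.2 ht12
  obtain ⟨α, w', q, hgq⟩ : ∃ (α w' : ℝ) (q : Space 2), EqOn g (conformalField α w' q) Ω := by
    refine ⟨(t₂ - t₁)⁻¹ * (fderiv ℝ a (t₂, x₀) (1, 0) / 2 - fderiv ℝ a (t₁, x₀) (1, 0) / 2),
      (t₂ - t₁)⁻¹ * (w₂ - w₁), (t₂ - t₁)⁻¹ • (p₂ - p₁), fun x hx => ?_⟩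
    have e : g x = (t₂ - t₁)⁻¹ • (b (t₂, x) - b (t₁, x)) := by
      rw [hbaff t₂ ht₂ x hx, add_sub_cancel_left, smul_smul, inv_mul_cancel₀ h21, one_smul]
    rw [e, show b (t₂, x) = _ from h₂ hx, show b (t₁, x) = _ from h₁ hx]
    simp only [conformalField]
    module
  -- `g` is a gradient, so that its rotational part vanishes
  have hC : ∀ x ∈ Ω, HasFDerivAt (fun y => c (t₁, y)) (-(2 : ℝ) • innerSL ℝ (g x)) x := by
    intro x hx
    refine (dx hc t₁ ht₁ x hx).congr_fderiv (ContinuousLinearMap.ext fun v => ?_)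
    have := hbt (t₁, x) ⟨ht₁, hx⟩ v
    simp only [smul_apply, innerSL_apply_apply, smul_eq_mul, ContinuousLinearMap.comp_apply,
      ContinuousLinearMap.inr_apply]
    linarith
  have hw' : w' = 0 := by
    have hd : HasFDerivAt (fun x => -(2 : ℝ) • innerSL ℝ (g x)) (-(2 : ℝ) •
        (innerSL ℝ : Space 2 →L[ℝ] Space 2 →L[ℝ] ℝ).comp
          (α • ContinuousLinearMap.id ℝ (Space 2) + w' • quarterTurn)) x₀ := by
      have h1 : HasFDerivAt g _ x₀ := (hasFDerivAt_conformalField α w' q x₀).congr_of_eventuallyEq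
        (by filter_upwards [hΩ.mem_nhds hx₀] with y hy using hgq hy)
      exact ((innerSL ℝ : Space 2 →L[ℝ] Space 2 →L[ℝ] ℝ).hasFDerivAt.comp x₀ h1).fun_const_smul _
    have hs := second_derivative_symmetric_of_eventually (f := fun y => c (t₁, y)) (by
      filter_upwards [hΩ.mem_nhds hx₀] with y hy using hC y hy) hd
      (EuclideanSpace.single 0 1) (EuclideanSpace.single 1 1)
    simp [innerSL_apply_apply ℝ, inner_eq_coord] at hs
    linarith
  subst hw'
  obtain ⟨c₀, hc₀⟩ := hΩ.exists_is_const_of_fderiv_eq_zero hΩc.isPreconnected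
    (f := fun x => c (t₁, x) + (α * ‖x‖ ^ 2 + 2 * inner ℝ q x)) (fun x hx => by
      refine ((hC x hx).differentiableAt.add ?_).differentiableWithinAt
      exact ((differentiableAt_id.norm_sq ℝ).const_mul α).add
        (((differentiableAt_const q).inner ℝ differentiableAt_id).const_mul 2)) (by
    intro x hx
    have h1 : HasFDerivAt (fun x : Space 2 => ‖x‖ ^ 2) (2 • innerSL ℝ x) x :=
      (hasStrictFDerivAt_norm_sq x).hasFDerivAt
    have h2 : HasFDerivAt (fun x : Space 2 => inner ℝ q x) (innerSL ℝ q) x :=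
      (innerSL ℝ q).hasFDerivAt
    have h3 := (hC x hx).add ((h1.const_mul α).add (h2.const_mul 2))
    refine h3.fderiv.trans ?_
    rw [hgq hx]
    ext v
    simp [conformalField, inner_eq_coord]
    ring)
  -- the value of `a` follows from the divergence of `b`
  set β : ℝ := 2 * (fderiv ℝ a (t₁, x₀) (1, 0) / 2 - t₁ * α) with hβ
  have hbfin : ∀ t ∈ I, ∀ x ∈ Ω,
      b (t, x) = conformalField (α * t + β / 2) w₁ (t • q + (p₁ - t₁ • q)) x := by
    intro t ht x hx
    rw [hbaff t ht x hx, show b (t₁, x) = _ from h₁ hx, hgq hx]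
    simp only [conformalField, hβ]
    module
  have ha' : ∀ t ∈ I, fderiv ℝ a (t, x₀) (1, 0) = 2 * α * t + β := by
    intro t ht
    have hd : HasFDerivAt (fun x => b (t, x)) _ x₀ :=
      (hasFDerivAt_conformalField (α * t + β / 2) w₁ (t • q + (p₁ - t₁ • q)) x₀
        ).congr_of_eventuallyEq
        (by filter_upwards [hΩ.mem_nhds hx₀] with y hy using hbfin t ht y hy)
    have e := (dx hb t ht x₀ hx₀).unique hd
    have e1 := hbx (t, x₀) ⟨ht, hx₀⟩ (EuclideanSpace.single 0 1)
    have e2 := DFunLike.congr_fun e (EuclideanSpace.single 0 1)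
    rw [ContinuousLinearMap.comp_apply, ContinuousLinearMap.inr_apply] at e2
    rw [e2] at e1
    simp [inner_eq_coord] at e1
    linarith
  obtain ⟨γ, hγ⟩ := hI.exists_is_const_of_deriv_eq_zero hIc
    (f := fun t => a (t, x₀) - (α * t ^ 2 + β * t))
    (fun t ht => ((dt ha t ht x₀ hx₀).differentiableAt.sub (by fun_prop)).differentiableWithinAt)
    (by
      intro t ht
      have h1 : HasDerivAt (fun t : ℝ => α * t ^ 2 + β * t) (2 * α * t + β) t := by
        have := ((hasDerivAt_pow 2 t).const_mul α).add ((hasDerivAt_id t).const_mul β)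
        refine this.congr_deriv ?_
        norm_num
        ring
      have h2 := (dt ha t ht x₀ hx₀).sub h1
      rw [ha' t ht, sub_self] at h2
      exact h2.deriv)
  refine ⟨c₀, α, β, γ, w₁, p₁ - t₁ • q, q, fun t ht x hx => ⟨?_, hbfin t ht x hx, ?_⟩⟩
  · rw [haA t ht x hx, ← hγ t ht]; ring
  · rw [hcC t ht x hx, ← hc₀ x hx]; ring

/-! ### Positivity, closed time interval and boundary values -/

lemma openTimeInterval_nonempty {T : EReal} (hT : 0 < T) : (openTimeInterval T).Nonempty := by
  obtain ⟨t, h0, h1⟩ := EReal.lt_iff_exists_real_btwn.1 hT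
  exact ⟨t, by exact_mod_cast h0, h1⟩

lemma isPreconnected_openTimeInterval (T : EReal) : IsPreconnected (openTimeInterval T) := by
  refine OrdConnected.isPreconnected ⟨fun s hs t ht r hr => ⟨hs.1.trans_le hr.1, ?_⟩⟩
  exact lt_of_le_of_lt (EReal.coe_le_coe_iff.2 hr.2) ht.2

lemma timeInterval_subset_closure {T : EReal} (hT : 0 < T) :
    timeInterval T ⊆ closure (openTimeInterval T) := by
  induction T with
  | bot => simp at hT
  | top =>
    have h : openTimeInterval ⊤ = Ioi 0 := by ext t; simp [openTimeInterval, EReal.coe_lt_top]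
    rw [h, closure_Ioi]
    exact fun t ht => ht.1
  | coe T =>
    have h : openTimeInterval T = Ioo 0 T := by ext t; simp [openTimeInterval]
    have hT' : (0 : ℝ) < T := by exact_mod_cast hT
    rw [h, closure_Ioo hT'.ne]
    exact fun t ht => ⟨ht.1, by exact_mod_cast ht.2⟩

/-- In space-time, free transport says that the derivative along `(1, v)` vanishes. -/
lemma SolvesFreeTransport.fderiv_eq_zero {T : EReal} {Ω : Set (Space 2)}
    {m : ℝ → Space 2 → Space 2 → ℝ} (h : SolvesFreeTransport T Ω m) {t : ℝ}
    (ht : t ∈ openTimeInterval T) {x : Space 2} (hx : x ∈ Ω) (v : Space 2) :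
    fderiv ℝ (fun z : ℝ × Space 2 => m z.1 z.2 v) (t, x) (1, v) = 0 := by
  obtain ⟨hd, he⟩ := h t ht x hx v
  have h1 : HasDerivAt (fun s => m s x v)
      (fderiv ℝ (fun z : ℝ × Space 2 => m z.1 z.2 v) (t, x) (1, 0)) t := by
    have h := hd.hasFDerivAt.comp_hasDerivAt t ((hasDerivAt_id t).prodMk (hasDerivAt_const t x))
    exact h
  have h2 : HasFDerivAt (fun y => m t y v)
      ((fderiv ℝ (fun z : ℝ × Space 2 => m z.1 z.2 v) (t, x)).comp
        (ContinuousLinearMap.inr ℝ ℝ (Space 2))) x :=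
    hd.hasFDerivAt.comp x (hasFDerivAt_prodMk_right t x)
  rw [h1.deriv, real_inner_comm, inner_gradient_left, h2.fderiv] at he
  rw [show ((1 : ℝ), v) = (1, 0) + (0, v) by simp, map_add]
  exact he

/-- The density of a transported local Maxwellian does not vanish: if it did at one point, then
the function would vanish along all the characteristics issued from it, and the density on the
open set of space-time that they fill. -/
lemma density_pos {T : EReal} {Ω : Set (Space 2)} (hΩ : IsOpen Ω)
    {m : ℝ → Space 2 → Space 2 → ℝ} (hm : SolvesFreeTransport T Ω m)
    {ρ a : ℝ → Space 2 → ℝ} {u : ℝ → Space 2 → Space 2}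
    (hρ : ∀ t ∈ timeInterval T, ∀ x ∈ Ω, 0 ≤ ρ t x)
    (hae : ∀ᵐ z : ℝ × Space 2, z ∈ timeInterval T ×ˢ Ω → 0 < ρ z.1 z.2)
    (hmax : ∀ t ∈ timeInterval T, ∀ x ∈ Ω, ∀ v : Space 2,
      m t x v = ρ t x * Real.exp (-(a t x * ‖v - u t x‖ ^ 2)))
    {t₀ : ℝ} (ht₀ : t₀ ∈ openTimeInterval T) {x₀ : Space 2} (hx₀ : x₀ ∈ Ω) : 0 < ρ t₀ x₀ := by
  refine lt_of_le_of_ne (hρ t₀ (openTimeInterval_subset T ht₀) x₀ hx₀) fun h0 => ?_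
  have hopen : IsOpen (openTimeInterval T ×ˢ Ω) := (isOpen_openTimeInterval T).prod hΩ
  obtain ⟨ε, hε, hball⟩ :=
    Metric.mem_nhds_iff.1 (hopen.mem_nhds (show (t₀, x₀) ∈ _ from ⟨ht₀, hx₀⟩))
  have hzero : ∀ z ∈ Metric.ball (t₀, x₀) ε, t₀ < z.1 → ρ z.1 z.2 = 0 := by
    rintro ⟨t, y⟩ hz (hlt : t₀ < t)
    set v : Space 2 := (t - t₀)⁻¹ • (y - x₀) with hv
    have htt : t - t₀ ≠ 0 := (sub_pos.2 hlt).ne'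
    have hvy : (t - t₀) • v = y - x₀ := by rw [hv, smul_smul, mul_inv_cancel₀ htt, one_smul]
    set γ : ℝ → ℝ × Space 2 := fun s => (t₀, x₀) + s • (t - t₀, y - x₀) with hγ
    have hmem : ∀ s ∈ Icc (0 : ℝ) 1, γ s ∈ openTimeInterval T ×ˢ Ω := by
      intro s hs
      refine hball ((convex_ball _ _).add_smul_sub_mem (Metric.mem_ball_self hε) hz hs)
    have hder : ∀ s ∈ Icc (0 : ℝ) 1, HasDerivAt (fun s => m (γ s).1 (γ s).2 v) 0 s := by
      intro s hs
      have hg : HasDerivAt γ (t - t₀, y - x₀) s := by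
        have h := ((hasDerivAt_id s).smul_const (t - t₀, y - x₀)).const_add (t₀, x₀)
        rwa [one_smul] at h
      have hd := (hm _ (hmem s hs).1 _ (hmem s hs).2 v).1
      have h1 := hd.hasFDerivAt.comp_hasDerivAt s hg
      have e : (t - t₀, y - x₀) = (t - t₀) • ((1 : ℝ), v) := by simp [hvy]
      refine h1.congr_deriv ?_
      rw [e, map_smul, hm.fderiv_eq_zero (hmem s hs).1 (hmem s hs).2, smul_zero]
    have hc := constant_of_has_deriv_right_zero (f := fun s => m (γ s).1 (γ s).2 v)
      (fun s hs => (hder s hs).continuousAt.continuousWithinAt)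
      (fun s hs => (hder s ⟨hs.1, hs.2.le⟩).hasDerivWithinAt) 1 (by simp)
    have hUz := hball hz
    simp [hγ] at hc
    rw [hmax t₀ (openTimeInterval_subset T ht₀) x₀ hx₀, ← h0, zero_mul,
      hmax t (openTimeInterval_subset T hUz.1) y hUz.2] at hc
    exact (mul_eq_zero.1 hc).resolve_right (Real.exp_pos _).ne'
  set S : Set (ℝ × Space 2) := Metric.ball (t₀, x₀) ε ∩ {z | t₀ < z.1} with hS
  have hSo : IsOpen S := Metric.isOpen_ball.inter (isOpen_lt continuous_const continuous_fst)
  have hSn : S.Nonempty := by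
    refine ⟨(t₀ + ε / 2, x₀), ?_, ?_⟩
    · simp [Prod.dist_eq, abs_of_pos hε, hε]
    · simp [hε]
  obtain ⟨z, hzS, hz⟩ :=
    ((frequently_ae_mem_iff.2 (hSo.measure_pos volume hSn).ne').and_eventually hae).exists
  have hUz := hball hzS.1
  exact (hz ⟨openTimeInterval_subset T hUz.1, hUz.2⟩).ne' (hzero z hzS.1 hzS.2)

/-- A Maxwellian as the exponential of a polynomial in the velocity. -/
lemma maxwellian_eq_exp {ρ : ℝ} (hρ : 0 < ρ) (a : ℝ) (u v : Space 2) :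
    ρ * Real.exp (-(a * ‖v - u‖ ^ 2)) =
      Real.exp (-(a * ‖v‖ ^ 2) + 2 * inner ℝ (a • u) v + (Real.log ρ - a * ‖u‖ ^ 2)) := by
  rw [norm_sub_sq_real, inner_smul_left, real_inner_comm u v, conj_trivial]
  conv_lhs => rw [← Real.exp_log hρ, ← Real.exp_add]
  congr 1
  ring

/-- If the inverse temperature `a = α t² + β t + γ` of a transported Maxwellian vanished at
some time, the velocity field `u = b / a` would blow up there: the difference of its values at two
points has the component `a' / (2 a)` along their separation. -/
lemma inverseTemperature_pos {S : Set ℝ} {α β γ w : ℝ} {p q : Space 2}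
    {u : ℝ → Space 2 → Space 2} {x y : Space 2} (hxy : x ≠ y)
    (hS : ∀ t ∈ S, t ∈ closure (S \ {t}))
    (hpos : ∃ t ∈ S, 0 < α * t ^ 2 + β * t + γ)
    (hnn : ∀ t ∈ S, 0 ≤ α * t ^ 2 + β * t + γ)
    (hux : ContinuousOn (fun t => u t x) S) (huy : ContinuousOn (fun t => u t y) S)
    (hbx : ∀ t ∈ S, (α * t ^ 2 + β * t + γ) • u t x =
      conformalField (α * t + β / 2) w (t • q + p) x)
    (hby : ∀ t ∈ S, (α * t ^ 2 + β * t + γ) • u t y =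
      conformalField (α * t + β / 2) w (t • q + p) y) :
    ∀ t ∈ S, 0 < α * t ^ 2 + β * t + γ := by
  intro t₀ ht₀
  refine lt_of_le_of_ne (hnn t₀ ht₀) fun h0 => ?_
  have hN : ‖x - y‖ ^ 2 ≠ 0 := by simpa [sub_eq_zero] using hxy
  set h : ℝ → ℝ := fun t => inner ℝ (u t x - u t y) (x - y) / ‖x - y‖ ^ 2 with hh
  have hc : ContinuousOn h S := by
    refine ContinuousOn.div_const ?_ _
    exact (hux.sub huy).inner continuousOn_const
  have hA : ∀ t ∈ S, (α * t ^ 2 + β * t + γ) * h t = α * t + β / 2 := by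
    intro t ht
    have e : inner ℝ ((α * t ^ 2 + β * t + γ) • (u t x - u t y)) (x - y)
        = (α * t + β / 2) * ‖x - y‖ ^ 2 := by
      rw [smul_sub, hbx t ht, hby t ht]
      simp only [conformalField, inner_eq_coord, norm_sq_eq_coord, PiLp.sub_apply,
        PiLp.smul_apply, PiLp.add_apply, quarterTurn_zero_coord, quarterTurn_one_coord,
        smul_eq_mul]
      ring
    rw [inner_smul_left, conj_trivial] at e
    rw [hh, ← mul_div_assoc, e, mul_div_assoc, div_self hN, mul_one]
  have h1 : α * t₀ + β / 2 = 0 := by rw [← hA t₀ ht₀, ← h0, zero_mul]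
  -- `t₀` is a double root
  have h2 : ∀ t, α * t ^ 2 + β * t + γ = α * (t - t₀) ^ 2 := fun t => by
    linear_combination (2 * (t - t₀)) * h1 - h0
  have hα : α ≠ 0 := by
    rintro rfl
    obtain ⟨t, _, ht⟩ := hpos
    rw [h2 t] at ht
    simp at ht
  have h3 : ∀ t ∈ S \ {t₀}, (t - t₀) * h t = 1 := by
    rintro t ⟨ht, hne⟩
    have hne' : α * (t - t₀) ≠ 0 := mul_ne_zero hα (sub_ne_zero.2 hne)
    have e := hA t ht
    rw [h2 t] at e
    apply mul_left_cancel₀ hne'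
    linear_combination e + h1
  have h4 : ContinuousOn (fun t => (t - t₀) * h t) S := by fun_prop
  have h5 : (fun t => (t - t₀) * h t) t₀ = (fun _ => (1 : ℝ)) t₀ := by
    have : (𝓝[S \ {t₀}] t₀).NeBot := mem_closure_iff_nhdsWithin_neBot.1 (hS t₀ ht₀)
    have l1 := ((h4 t₀ ht₀).mono sdiff_subset).tendsto (s := S \ {t₀})
    have l2 : Tendsto (fun t => (t - t₀) * h t) (𝓝[S \ {t₀}] t₀) (𝓝 1) :=
      tendsto_const_nhds.congr' (by
        filter_upwards [self_mem_nhdsWithin] with t ht using (h3 t ht).symm)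
    exact tendsto_nhds_unique l1 l2
  simp at h5

/-- A local Maxwellian carried by free transport in a connected domain of the plane is, up to
the boundary, the exponential of a `freeExponent`; its boundary condition says that the two
fields composing its momentum are tangent to the boundary. -/
theorem exists_freeExponent {T : EReal} (hT : 0 < T) {Ω : Set (Space 2)} (hΩ : IsOpen Ω)
    (hΩc : IsConnected Ω) {m : ℝ → Space 2 → Space 2 → ℝ} (hm : IsSpecularMaxwellian T Ω m) :
    ∃ (c α β γ w : ℝ) (p q : Space 2),
      (∀ t ∈ timeInterval T, 0 < α * t ^ 2 + β * t + γ) ∧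
      (∀ t ∈ timeInterval T, ∀ x ∈ closure Ω, ∀ v,
        m t x v = Real.exp (freeExponent c α β γ w p q (x - t • v) v)) ∧
      IsTangentField Ω (conformalField α 0 q) ∧
      IsTangentField Ω (conformalField (β / 2) w p) := by
  obtain ⟨⟨ρ, a, u, hnn, hae, hρd, had, hud, hu2, hmax⟩, hcont, htr, hbc⟩ := hm
  have hsub := openTimeInterval_subset T
  have hopen : IsOpen (openTimeInterval T ×ˢ Ω) := (isOpen_openTimeInterval T).prod hΩ
  have hss : openTimeInterval T ×ˢ Ω ⊆ timeInterval T ×ˢ Ω := prod_mono hsub subset_rfl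
  have hρpos : ∀ t ∈ openTimeInterval T, ∀ x ∈ Ω, 0 < ρ t x := fun t ht x hx =>
    density_pos hΩ htr (fun t ht x hx => (hnn t ht x hx).1)
      (hae.mono fun z hz hzU => (hz hzU).1) hmax ht hx
  set a' : ℝ × Space 2 → ℝ := fun z => a z.1 z.2 with ha'
  set b' : ℝ × Space 2 → Space 2 := fun z => a z.1 z.2 • u z.1 z.2 with hb'
  set c' : ℝ × Space 2 → ℝ := fun z => Real.log (ρ z.1 z.2) - a z.1 z.2 * ‖u z.1 z.2‖ ^ 2 with hc'
  have hexp : ∀ t ∈ openTimeInterval T, ∀ x ∈ Ω, ∀ v, m t x v =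
      Real.exp (-(a' (t, x) * ‖v‖ ^ 2) + 2 * inner ℝ (b' (t, x)) v + c' (t, x)) := by
    intro t ht x hx v
    rw [hmax t (hsub ht) x hx, maxwellian_eq_exp (hρpos t ht x hx)]
  have had' : DifferentiableOn ℝ a' (openTimeInterval T ×ˢ Ω) := had.mono hss
  have hbd' : DifferentiableOn ℝ b' (openTimeInterval T ×ˢ Ω) := had'.smul (hud.mono hss)
  have hcd' : DifferentiableOn ℝ c' (openTimeInterval T ×ˢ Ω) :=
    ((hρd.mono hss).log fun z hz => (hρpos z.1 hz.1 z.2 hz.2).ne').sub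
      (had'.mul ((hud.mono hss).norm_sq ℝ))
  have hcoef := fun (z : ℝ × Space 2) (hz : z ∈ openTimeInterval T ×ˢ Ω) =>
    transport_coeff (had'.differentiableAt (hopen.mem_nhds hz))
      (hbd'.differentiableAt (hopen.mem_nhds hz)) (hcd'.differentiableAt (hopen.mem_nhds hz)) (by
      intro v
      have hd : DifferentiableAt ℝ
          (fun y => -(a' y * ‖v‖ ^ 2) + 2 * inner ℝ (b' y) v + c' y) z :=
        ((((had'.differentiableAt (hopen.mem_nhds hz)).mul_const _).neg).add
          (((hbd'.differentiableAt (hopen.mem_nhds hz)).inner ℝ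
            (differentiableAt_const v)).const_mul 2)).add
          (hcd'.differentiableAt (hopen.mem_nhds hz))
      have he : (fun y : ℝ × Space 2 => m y.1 y.2 v) =ᶠ[𝓝 z] fun y =>
          Real.exp (-(a' y * ‖v‖ ^ 2) + 2 * inner ℝ (b' y) v + c' y) := by
        filter_upwards [hopen.mem_nhds hz] with y hy using hexp y.1 hy.1 y.2 hy.2 v
      have h0 := htr.fderiv_eq_zero hz.1 hz.2 v
      rw [Prod.mk.eta, he.fderiv_eq, hd.hasFDerivAt.exp.fderiv] at h0
      simpa using h0)
  have hb2 : ∀ t ∈ openTimeInterval T, DifferentiableOn ℝ (fderiv ℝ fun x => b' (t, x)) Ω := by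
    intro t ht
    -- `a` does not depend on `x`, so that the regularity of `u` passes to `b`
    obtain ⟨x₀, hx₀⟩ := hΩc.nonempty
    have hconst : ∀ x ∈ Ω, a t x = a t x₀ := fun x hx =>
      hΩ.is_const_of_fderiv_eq_zero (f := fun y => a t y) hΩc.isPreconnected
        (fun y hy => ((had'.differentiableAt
          (hopen.mem_nhds (show (t, y) ∈ _ from ⟨ht, hy⟩))).comp y (hasFDerivAt_prodMk_right t y).differentiableAt).differentiableWithinAt)
        (fun y hy => by
          have h1 := (had'.differentiableAt (hopen.mem_nhds (show (t, y) ∈ _ from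
            ⟨ht, hy⟩))).hasFDerivAt.comp y (hasFDerivAt_prodMk_right t y)
          refine h1.fderiv.trans ?_
          ext v
          exact (hcoef (t, y) ⟨ht, hy⟩).1 v) hx hx₀
    refine ((hu2 t (hsub ht)).const_smul (a t x₀)).congr fun x hx => ?_
    have he : (fun x => b' (t, x)) =ᶠ[𝓝 x] fun y => a t x₀ • u t y := by
      filter_upwards [hΩ.mem_nhds hx] with y hy
      rw [hb']
      simp only [hconst y hy]
    have hux : DifferentiableAt ℝ (u t) x :=
      ((hud.mono hss).differentiableAt (hopen.mem_nhds (show (t, x) ∈ _ from ⟨ht, hx⟩))).comp x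
        (hasFDerivAt_prodMk_right t x).differentiableAt
    rw [he.fderiv_eq, fderiv_fun_const_smul hux]
    rfl
  obtain ⟨c, α, β, γ, w, p, q, hform⟩ := exists_coeff_of_transport (isOpen_openTimeInterval T)
    (isPreconnected_openTimeInterval T) (openTimeInterval_nonempty hT) hΩ hΩc had' hbd' hcd' hb2
    (fun z hz => (hcoef z hz).1) (fun z hz => (hcoef z hz).2.1) (fun z hz => (hcoef z hz).2.2.1)
    (fun z hz => (hcoef z hz).2.2.2)
  have hall : ∀ t ∈ timeInterval T, ∀ x ∈ closure Ω, ∀ v,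
      m t x v = Real.exp (freeExponent c α β γ w p q (x - t • v) v) := by
    have heq : EqOn (fun z : ℝ × Space 2 × Space 2 => m z.1 z.2.1 z.2.2)
        (fun z => Real.exp (freeExponent c α β γ w p q (z.2.1 - z.1 • z.2.2) z.2.2))
        (timeInterval T ×ˢ (closure Ω ×ˢ univ)) := by
      refine EqOn.of_subset_closure (s := openTimeInterval T ×ˢ (Ω ×ˢ univ)) ?_ hcont
        (Continuous.continuousOn ?_) (prod_mono hsub (prod_mono subset_closure subset_rfl)) ?_
      · rintro ⟨t, x, v⟩ ⟨ht, hx, -⟩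
        obtain ⟨e1, e2, e3⟩ := hform t ht x hx
        simp only
        rw [hexp t ht x hx v, e1, e2, e3, freeExponent_sub_smul]
      · exact Real.continuous_exp.comp ((continuous_freeExponent c α β γ w p q).comp
          (f := fun z : ℝ × Space 2 × Space 2 => (z.2.1 - z.1 • z.2.2, z.2.2)) (by fun_prop))
      · rw [closure_prod_eq, closure_prod_eq, closure_univ]
        exact prod_mono (timeInterval_subset_closure hT) subset_rfl
    exact fun t ht x hx v => heq (x := (t, x, v)) ⟨ht, hx, trivial⟩
  refine ⟨c, α, β, γ, w, p, q, ?_, hall, ?_⟩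
  · -- identification of the coefficients of the Maxwellian on the closed time interval
    have hid : ∀ t ∈ timeInterval T, ∀ x ∈ Ω, a t x = α * t ^ 2 + β * t + γ ∧
        a t x • u t x = conformalField (α * t + β / 2) w (t • q + p) x := by
      intro t ht x hx
      have h1 : ∀ v, ρ t x * Real.exp (-(a t x * ‖v - u t x‖ ^ 2)) =
          Real.exp (freeExponent c α β γ w p q (x - t • v) v) := fun v => by
        rw [← hmax t ht x hx, hall t ht x (subset_closure hx)]
      have hρ : 0 < ρ t x := by
        have := Real.exp_pos (freeExponent c α β γ w p q (x - t • (0 : Space 2)) 0)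
        rw [← h1 0] at this
        exact pos_of_mul_pos_left this (Real.exp_pos _).le
      simp only [maxwellian_eq_exp hρ, freeExponent_sub_smul, Real.exp_eq_exp] at h1
      have h2 := quadratic_coeff_unique h1
      exact ⟨h2.1, h2.2.1⟩
    obtain ⟨x, hx⟩ := hΩc.nonempty
    obtain ⟨y, hy, hyx⟩ : ∃ y ∈ Ω, y ≠ x := by
      by_contra! h
      have h1 : Ω = {x} := eq_singleton_iff_unique_mem.2 ⟨hx, h⟩
      exact not_isOpen_singleton x (h1 ▸ hΩ)
    have hu : ∀ z ∈ Ω, ContinuousOn (fun t => u t z) (timeInterval T) := fun z hz =>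
      hud.continuousOn.comp (f := fun t => (t, z)) (by fun_prop) fun t ht => ⟨ht, hz⟩
    refine inverseTemperature_pos (w := w) (p := p) (q := q) hyx.symm ?_ ?_ ?_
      (hu x hx) (hu y hy) ?_ ?_
    · intro t ht
      have h1 := timeInterval_subset_closure hT ht
      refine closure_mono (s := openTimeInterval T \ {t}) (sdiff_subset_sdiff_left hsub) ?_
      have h2 := (isOpen_openTimeInterval T)
      have : closure (openTimeInterval T \ {t}) = closure (openTimeInterval T) := by
        have hd : Dense ({t}ᶜ : Set ℝ) := dense_compl_singleton t
        rw [sdiff_eq]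
        refine subset_antisymm (closure_mono inter_subset_left) ?_
        exact closure_minimal (hd.open_subset_closure_inter h2) isClosed_closure
      rw [this]; exact h1
    · have hpos' : (0 : ENNReal) < volume (openTimeInterval T ×ˢ Ω) :=
        hopen.measure_pos volume ((openTimeInterval_nonempty hT).prod hΩc.nonempty)
      obtain ⟨z, hzU, hz⟩ := ((frequently_ae_mem_iff.2 hpos'.ne').and_eventually hae).exists
      refine ⟨z.1, hsub hzU.1, ?_⟩
      rw [← (hid z.1 (hsub hzU.1) z.2 hzU.2).1]
      exact (hz (hss hzU)).2
    · intro t ht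
      rw [← (hid t ht x hx).1]
      exact (hnn t ht x hx).2
    · intro t ht
      rw [← (hid t ht x hx).1]; exact (hid t ht x hx).2
    · intro t ht
      rw [← (hid t ht y hy).1]; exact (hid t ht y hy).2
  · have hb : ∀ t ∈ timeInterval T, ∀ x ∈ frontier Ω, ∀ n, IsUnitNormal Ω x n →
        t * inner ℝ n (conformalField α 0 q x)
          + inner ℝ n (conformalField (β / 2) w p x) = 0 := by
      intro t ht x hx n hn
      have hxc := frontier_subset_closure hx
      have h1 := hbc t ht x hx n hn n
      rw [hall t ht x hxc, hall t ht x hxc] at h1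
      have h2 := Real.exp_injective h1
      rw [freeExponent_sub_smul, freeExponent_sub_smul, reflect_norm_sq hn.1,
        inner_sub_right _ n, inner_smul_right, real_inner_self_eq_norm_sq, hn.1,
        real_inner_comm] at h2
      have e : conformalField (α * t + β / 2) w (t • q + p) x =
          t • conformalField α 0 q x + conformalField (β / 2) w p x := by
        simp only [conformalField]; module
      rw [e, inner_add_right, inner_smul_right] at h2
      linarith
    have h0 : ∀ x ∈ frontier Ω, ∀ n, IsUnitNormal Ω x n →
        inner ℝ n (conformalField (β / 2) w p x) = 0 := fun x hx n hn => by
      simpa using hb 0 (zero_mem_timeInterval hT) x hx n hn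
    refine ⟨fun x hx n hn => ?_, h0⟩
    obtain ⟨t, ht⟩ := openTimeInterval_nonempty hT
    have h1 := hb t (hsub ht) x hx n hn
    rw [h0 x hx n hn, add_zero] at h1
    exact (mul_eq_zero.1 h1).resolve_left ht.1.ne'

/-! ### Regular boundaries -/

lemma IsLocalBoundaryEquation.hasStrictFDerivAt {Ω : Set (Space 2)} {x : Space 2}
    {g : Space 2 → ℝ} (hg : IsLocalBoundaryEquation Ω x g) :
    HasStrictFDerivAt g (innerSL ℝ (gradient g x)) x := by
  have h := hg.1.hasStrictFDerivAt (by norm_num)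
  have e : fderiv ℝ g x = innerSL ℝ (gradient g x) := by
    ext v
    rw [innerSL_apply_apply, inner_gradient_left]
  rwa [e] at h

/-- The normalized gradient of a local equation is a unit normal. -/
lemma IsLocalBoundaryEquation.isUnitNormal {Ω : Set (Space 2)} {x : Space 2}
    {g : Space 2 → ℝ} (hg : IsLocalBoundaryEquation Ω x g) :
    IsUnitNormal Ω x (‖gradient g x‖⁻¹ • gradient g x) := by
  have h0 : ‖gradient g x‖ ≠ 0 := norm_ne_zero_iff.2 hg.2.1
  refine ⟨by rw [norm_smul, norm_inv, norm_norm, inv_mul_cancel₀ h0], g, hg, ‖gradient g x‖, ?_⟩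
  rw [smul_smul, mul_inv_cancel₀ h0, one_smul]

lemma IsTangentField.inner_gradient {Ω : Set (Space 2)} {V : Space 2 → Space 2}
    (hV : IsTangentField Ω V) {x : Space 2} (hx : x ∈ frontier Ω) {g : Space 2 → ℝ}
    (hg : IsLocalBoundaryEquation Ω x g) : inner ℝ (gradient g x) (V x) = 0 := by
  have h := hV x hx _ hg.isUnitNormal
  rw [inner_smul_left, conj_trivial] at h
  exact (mul_eq_zero.1 h).resolve_left (inv_ne_zero (norm_ne_zero_iff.2 hg.2.1))

/-- The gradient of a local equation is orthogonal to the velocity of any curve that meets the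
boundary infinitely often near its origin. -/
lemma IsLocalBoundaryEquation.inner_eq_zero_of_frequently {Ω : Set (Space 2)} {x d : Space 2}
    {g : Space 2 → ℝ} (hg : IsLocalBoundaryEquation Ω x g) (hx : x ∈ frontier Ω)
    {c : ℝ → Space 2} (hc : HasDerivAt c d 0) (hc0 : c 0 = x)
    (hfr : ∃ᶠ r in 𝓝[≠] (0 : ℝ), c r ∈ frontier Ω) : inner ℝ (gradient g x) d = 0 := by
  subst hc0
  have hd : HasDerivAt (g ∘ c) (inner ℝ (gradient g (c 0)) d) 0 :=
    hg.hasStrictFDerivAt.hasFDerivAt.comp_hasDerivAt 0 hc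
  have hg0 : (g ∘ c) 0 = 0 := (hg.2.2.self_of_nhds).1 hx
  by_contra hne
  have h1 := hd.eventually_ne hne (c := (g ∘ c) 0)
  have h2 : ∀ᶠ r in 𝓝[≠] (0 : ℝ), (c r ∈ frontier Ω ↔ g (c r) = 0) :=
    (hc.continuousAt.eventually hg.2.2).filter_mono nhdsWithin_le_nhds
  obtain ⟨r, hr, hr1, hr2⟩ := (hfr.and_eventually (h1.and h2)).exists
  exact hr1 (by rw [hg0]; exact hr2.1 hr)

lemma IsUnitNormal.inner_eq_zero_of_frequently {Ω : Set (Space 2)} {x d n : Space 2}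
    (hn : IsUnitNormal Ω x n) (hx : x ∈ frontier Ω)
    {c : ℝ → Space 2} (hc : HasDerivAt c d 0) (hc0 : c 0 = x)
    (hfr : ∃ᶠ r in 𝓝[≠] (0 : ℝ), c r ∈ frontier Ω) : inner ℝ n d = 0 := by
  obtain ⟨-, g, hg, k, hk⟩ := hn
  have h := hg.inner_eq_zero_of_frequently hx hc hc0 hfr
  rw [hk, inner_smul_left, conj_trivial] at h
  refine (mul_eq_zero.1 h).resolve_left ?_
  rintro rfl
  exact hg.2.1 (by rw [hk, zero_smul])

/-- At a boundary point closest to `x`, the direction of `x` is normal to the boundary. -/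
lemma IsLocalBoundaryEquation.inner_sub_eq_zero_of_closest {Ω : Set (Space 2)} {x y V : Space 2}
    {g : Space 2 → ℝ} (hg : IsLocalBoundaryEquation Ω y g) (hy : y ∈ frontier Ω)
    (hmin : ∀ z ∈ frontier Ω, dist x y ≤ dist x z) (hV : inner ℝ (gradient g y) V = 0) :
    inner ℝ (x - y) V = 0 := by
  have hφ : HasStrictFDerivAt (fun z : Space 2 => ‖z - x‖ ^ 2) (2 • innerSL ℝ (y - x)) y := by
    have h1 := (hasStrictFDerivAt_norm_sq (y - x)).comp y ((hasStrictFDerivAt_id y).sub_const x)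
    rwa [ContinuousLinearMap.comp_id] at h1
  have hg0 : g y = 0 := (hg.2.2.self_of_nhds).1 hy
  have hext : IsLocalExtrOn (fun z : Space 2 => ‖z - x‖ ^ 2) {z | g z = g y} y := by
    refine Or.inl ?_
    filter_upwards [nhdsWithin_le_nhds hg.2.2, self_mem_nhdsWithin] with z hz hzg
    have h1 := hmin z (hz.2 (by rw [← hg0]; exact hzg))
    rw [dist_comm x y, dist_comm x z, dist_eq_norm, dist_eq_norm] at h1
    gcongr
  obtain ⟨a, b, hab, h⟩ := hext.exists_multipliers_of_hasStrictFDerivAt_1d hg.hasStrictFDerivAt hφ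
  have hb : b ≠ 0 := by
    rintro rfl
    have h1 := DFunLike.congr_fun h (gradient g y)
    simp only [zero_smul, add_zero, smul_apply, innerSL_apply_apply, smul_eq_mul,
      zero_apply] at h1
    rcases mul_eq_zero.1 h1 with h2 | h2
    · exact hab (by rw [h2]; rfl)
    · exact hg.2.1 (inner_self_eq_zero.1 h2)
  have h1 := DFunLike.congr_fun h V
  simp only [add_apply, smul_apply, innerSL_apply_apply, smul_eq_mul, zero_apply, hV, mul_zero,
    zero_add, nsmul_eq_mul] at h1
  have h2 : inner ℝ (y - x) V = 0 := by simpa [hb] using h1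
  rw [← neg_sub, inner_neg_left, h2, neg_zero]

/-- Near a boundary point, every line parallel to the normal crosses the boundary. -/
lemma IsLocalBoundaryEquation.exists_crossing {Ω : Set (Space 2)} {z : Space 2}
    {g : Space 2 → ℝ} (hg : IsLocalBoundaryEquation Ω z g) (hz : z ∈ frontier Ω) (τ : Space 2)
    {ε : ℝ} (hε : 0 < ε) :
    ∃ δ > 0, ∀ η : ℝ, |η| < δ → ∃ s : ℝ, |s| < ε ∧
      z + s • gradient g z + η • τ ∈ frontier Ω := by
  set n := gradient g z with hn
  have hg0 : g z = 0 := (hg.2.2.self_of_nhds).1 hz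
  have hev : ∀ᶠ y in 𝓝 z, ContinuousAt g y ∧ (y ∈ frontier Ω ↔ g y = 0) :=
    ((hg.1.eventually (by norm_num)).mono fun y hy => hy.continuousAt).and hg.2.2
  set P : ℝ × ℝ → Space 2 := fun p => z + p.1 • n + p.2 • τ with hP
  have hPc : Continuous P := by fun_prop
  have hP0 : P (0, 0) = z := by simp [hP]
  have hevP : ∀ᶠ p in 𝓝 (0, 0), ContinuousAt g (P p) ∧ (P p ∈ frontier Ω ↔ g (P p) = 0) := by
    have := hPc.tendsto (0, 0)
    rw [hP0] at this
    exact this.eventually hev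
  obtain ⟨r, hr, hball⟩ := Metric.eventually_nhds_iff.1 hevP
  have hlocal : ∀ s η : ℝ, |s| < r → |η| < r →
      ContinuousAt g (P (s, η)) ∧ (P (s, η) ∈ frontier Ω ↔ g (P (s, η)) = 0) := by
    intro s η hs hη
    exact hball (by simp [Prod.dist_eq, hs, hη])
  have hd : HasDerivAt (fun s : ℝ => g (P (s, 0))) (‖n‖ ^ 2) 0 := by
    have h1 : HasDerivAt (fun s : ℝ => P (s, 0)) n 0 := by
      have h := (((hasDerivAt_id (0 : ℝ)).smul_const n).const_add z).add_const ((0 : ℝ) • τ)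
      rwa [one_smul] at h
    have h2 : HasFDerivAt g (innerSL ℝ n) (P (0, 0)) := by
      rw [hP0]; exact hg.hasStrictFDerivAt.hasFDerivAt
    have h3 := h2.comp_hasDerivAt (0 : ℝ) h1
    rw [innerSL_apply_apply, real_inner_self_eq_norm_sq] at h3
    exact h3
  have hpos : 0 < ‖n‖ ^ 2 := by have := norm_pos_iff.2 hg.2.1; positivity
  -- `g` is positive at `s₀` and negative at `-s₀`, for a small `s₀`
  obtain ⟨s₀, hs₀, hs₀ε, hs₀r, hgp, hgm⟩ : ∃ s₀ > 0, s₀ < ε ∧ s₀ < r ∧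
      0 < g (P (s₀, 0)) ∧ g (P (-s₀, 0)) < 0 := by
    have hslope := (hasDerivAt_iff_tendsto_slope.1 hd).eventually (lt_mem_nhds hpos)
    obtain ⟨δ, hδ, h⟩ := Metric.eventually_nhds_iff.1 (eventually_nhdsWithin_iff.1 hslope)
    have hs : ∀ s : ℝ, |s| < δ → s ≠ 0 → 0 < s⁻¹ * g (P (s, 0)) := by
      intro s hs hs0
      have := h (y := s) (by simpa using hs) hs0
      simpa [slope_def_field, hP0, hg0, div_eq_inv_mul] using this
    obtain ⟨s₀, h0, h1⟩ := exists_between (lt_min hδ (lt_min hε hr))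
    have hlt := lt_min_iff.1 h1
    have hlt' := lt_min_iff.1 hlt.2
    refine ⟨s₀, h0, hlt'.1, hlt'.2, ?_, ?_⟩
    · have := hs s₀ (by rw [abs_of_pos h0]; exact hlt.1) h0.ne'
      exact pos_of_mul_pos_right this (inv_pos.2 h0).le
    · have := hs (-s₀) (by rw [abs_neg, abs_of_pos h0]; exact hlt.1) (neg_ne_zero.2 h0.ne')
      rw [inv_neg, neg_mul, ← mul_neg] at this
      linarith [pos_of_mul_pos_right this (inv_pos.2 h0).le]
  have hcη : ∀ s : ℝ, |s| < r → ContinuousAt (fun η : ℝ => g (P (s, η))) 0 := fun s hs =>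
    ContinuousAt.comp (f := fun η : ℝ => P (s, η)) (hlocal s 0 hs (by simpa using hr)).1
      (by fun_prop)
  have e1 := (hcη s₀ (by rwa [abs_of_pos hs₀])).eventually (lt_mem_nhds hgp)
  have e2 := (hcη (-s₀) (by rwa [abs_neg, abs_of_pos hs₀])).eventually (gt_mem_nhds hgm)
  obtain ⟨δ, hδ, hδ'⟩ := Metric.eventually_nhds_iff.1 (e1.and e2)
  refine ⟨min δ r, lt_min hδ hr, fun η hη => ?_⟩
  have hη' := lt_min_iff.1 hη
  obtain ⟨f1, f2⟩ := hδ' (y := η) (by simpa using hη'.1)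
  have hcs : ContinuousOn (fun s : ℝ => g (P (s, η))) (Icc (-s₀) s₀) := by
    intro s hs
    have hs' : |s| < r := lt_of_le_of_lt (abs_le.2 hs) hs₀r
    exact (ContinuousAt.comp (f := fun s : ℝ => P (s, η)) (hlocal s η hs' hη'.2).1
      (by fun_prop)).continuousWithinAt
  obtain ⟨s, hs, hgs⟩ := intermediate_value_Icc (by linarith) hcs ⟨f2.le, f1.le⟩
  have hs' : |s| ≤ s₀ := abs_le.2 hs
  exact ⟨s, hs'.trans_lt hs₀ε, (hlocal s η (hs'.trans_lt hs₀r) hη'.2).2.2 hgs⟩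

/-! ### Invariance of the boundary under the flow of a tangent field -/

lemma inner_sub_conformalField_sub (l w : ℝ) (p x y : Space 2) :
    inner ℝ (x - y) (conformalField l w p x - conformalField l w p y) = l * ‖x - y‖ ^ 2 := by
  simp only [conformalField, inner_eq_coord, norm_sq_eq_coord, PiLp.sub_apply,
    PiLp.smul_apply, PiLp.add_apply, quarterTurn_zero_coord, quarterTurn_one_coord, smul_eq_mul]
  ring

/-- An integral curve of a tangent field that starts on the boundary remains on it: the derivative
of the square of its distance to the boundary is at most a multiple of it, because the closest
boundary points are reached along normal directions. -/
lemma IsTangentField.integralCurve_mem_of_nonneg {Ω : Set (Space 2)} (hreg : HasRegularBoundary Ω)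
    {l w : ℝ} {p : Space 2} (hV : IsTangentField Ω (conformalField l w p))
    {X : ℝ → Space 2} (hX : ∀ s, HasDerivAt X (conformalField l w p (X s)) s)
    (h0 : X 0 ∈ frontier Ω) {s : ℝ} (hs : 0 ≤ s) : X s ∈ frontier Ω := by
  have hcl : IsClosed (frontier Ω) := isClosed_frontier
  have hXc : Continuous X := continuous_iff_continuousAt.2 fun s => (hX s).continuousAt
  set f : ℝ → ℝ := fun s => Metric.infDist (X s) (frontier Ω) ^ 2 with hf
  have hfc : Continuous f := ((Metric.continuous_infDist_pt _).comp hXc).pow 2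
  have hle := le_gronwallBound_of_liminf_deriv_right_le (f := f) (f' := fun s => 2 * l * f s)
    (δ := 0) (K := 2 * l) (ε := 0) (a := 0) (b := s) hfc.continuousOn (by
      intro t _ r hr
      obtain ⟨y, hy, hdist⟩ := hcl.exists_infDist_eq_dist hreg.1 (X t)
      obtain ⟨g, hg⟩ := hreg.2 y hy
      have hort : inner ℝ (X t - y) (conformalField l w p y) = 0 :=
        hg.inner_sub_eq_zero_of_closest hy
          (fun z hz => hdist ▸ Metric.infDist_le_dist_of_mem hz) (hV.inner_gradient hy hg)
      have hd : HasDerivAt (fun s => ‖X s - y‖ ^ 2) (2 * l * f t) t := by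
        have h1 := ((hX t).sub_const y).norm_sq
        refine h1.congr_deriv ?_
        have h2 := inner_sub_conformalField_sub l w p (X t) y
        rw [inner_sub_right, hort, sub_zero] at h2
        rw [h2, hf]
        simp only [hdist, dist_eq_norm]
        ring
      have hsl := (hasDerivAt_iff_tendsto_slope.1 hd).eventually (gt_mem_nhds hr)
      have hsl' := hsl.filter_mono (nhdsWithin_mono t (fun z (hz : t < z) => hz.ne'))
      refine Eventually.frequently ?_
      filter_upwards [hsl', self_mem_nhdsWithin] with z hz (hzt : t < z)
      refine lt_of_le_of_lt ?_ hz
      rw [slope_def_field, div_eq_inv_mul]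
      have hft : f t = ‖X t - y‖ ^ 2 := by simp only [hf, hdist, dist_eq_norm]
      have hfz : f z ≤ ‖X z - y‖ ^ 2 := by
        simp only [hf]
        rw [← dist_eq_norm]
        exact pow_le_pow_left₀ Metric.infDist_nonneg (Metric.infDist_le_dist_of_mem hy) 2
      rw [hft]
      exact mul_le_mul_of_nonneg_left (by linarith) (inv_nonneg.2 (by linarith)))
    (by simp [hf, Metric.infDist_zero_of_mem h0])
    (fun t _ => by simp) s ⟨hs, le_rfl⟩
  rw [gronwallBound_ε0_δ0] at hle
  have : Metric.infDist (X s) (frontier Ω) = 0 :=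
    pow_eq_zero_iff (two_ne_zero) |>.1 (le_antisymm hle (sq_nonneg _))
  exact (hcl.mem_iff_infDist_zero hreg.1).2 this

lemma neg_conformalField (l w : ℝ) (p x : Space 2) :
    conformalField (-l) (-w) (-p) x = -conformalField l w p x := by
  simp only [conformalField]; module

lemma IsTangentField.integralCurve_mem {Ω : Set (Space 2)} (hreg : HasRegularBoundary Ω)
    {l w : ℝ} {p : Space 2} (hV : IsTangentField Ω (conformalField l w p))
    {X : ℝ → Space 2} (hX : ∀ s, HasDerivAt X (conformalField l w p (X s)) s)
    (h0 : X 0 ∈ frontier Ω) (s : ℝ) : X s ∈ frontier Ω := by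
  rcases le_total 0 s with hs | hs
  · exact hV.integralCurve_mem_of_nonneg hreg hX h0 hs
  · have hV' : IsTangentField Ω (conformalField (-l) (-w) (-p)) := fun x hx n hn => by
      rw [neg_conformalField, inner_neg_right, hV x hx n hn, neg_zero]
    have := hV'.integralCurve_mem_of_nonneg hreg (X := fun s => X (-s)) (fun s => by
      rw [neg_conformalField]
      have := (hX (-s)).scomp s (hasDerivAt_neg s)
      rwa [neg_one_smul] at this) (by simpa using h0) (neg_nonneg.2 hs)
    simpa using this

lemma IsTangentField.add_smul_mem {Ω : Set (Space 2)} (hreg : HasRegularBoundary Ω)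
    {p : Space 2} (hV : IsTangentField Ω (conformalField 0 0 p)) {x : Space 2}
    (hx : x ∈ frontier Ω) (s : ℝ) : x + s • p ∈ frontier Ω := by
  refine hV.integralCurve_mem hreg (X := fun s => x + s • p) (fun s => ?_) (by simpa using hx) s
  have h := ((hasDerivAt_id s).smul_const p).const_add x
  rw [one_smul] at h
  refine h.congr_deriv ?_
  simp [conformalField]

/-- The image of `x` under the rotation of angle `θ` around `z`. -/
noncomputable def rotateAbout (z : Space 2) (θ : ℝ) (x : Space 2) : Space 2 :=
  z + (Real.cos θ • (x - z) + Real.sin θ • quarterTurn (x - z))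

lemma quarterTurn_quarterTurn (x : Space 2) : quarterTurn (quarterTurn x) = -x := by
  ext i; fin_cases i <;> simp

lemma hasDerivAt_spiral (l w s : ℝ) (d : Space 2) :
    HasDerivAt (fun s => Real.exp (l * s) •
      (Real.cos (w * s) • d + Real.sin (w * s) • quarterTurn d))
      (l • (Real.exp (l * s) • (Real.cos (w * s) • d + Real.sin (w * s) • quarterTurn d))
        + w • quarterTurn (Real.exp (l * s) •
          (Real.cos (w * s) • d + Real.sin (w * s) • quarterTurn d))) s := by
  have hl : ∀ k : ℝ, HasDerivAt (fun s : ℝ => k * s) k s := fun k => by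
    simpa using (hasDerivAt_id s).const_mul k
  have h1 := (hl l).exp
  have h2 := ((hl w).cos.smul_const d).add ((hl w).sin.smul_const (quarterTurn d))
  refine (h1.smul h2).congr_deriv ?_
  simp only [map_smul, map_add, quarterTurn_quarterTurn, Pi.add_apply]
  module

/-- The boundary contains the logarithmic spirals issued from its points that are integral curves
of a tangent field vanishing at `z`. -/
lemma IsTangentField.spiral_mem {Ω : Set (Space 2)} (hreg : HasRegularBoundary Ω)
    {l w : ℝ} {p z : Space 2} (hV : IsTangentField Ω (conformalField l w p))
    (hz : conformalField l w p z = 0) {x : Space 2} (hx : x ∈ frontier Ω) (s : ℝ) :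
    z + Real.exp (l * s) • (Real.cos (w * s) • (x - z) + Real.sin (w * s) • quarterTurn (x - z))
      ∈ frontier Ω := by
  refine hV.integralCurve_mem hreg (X := fun s => z + Real.exp (l * s) •
    (Real.cos (w * s) • (x - z) + Real.sin (w * s) • quarterTurn (x - z))) (fun s => ?_)
    (by simpa using hx) s
  refine ((hasDerivAt_spiral l w s (x - z)).const_add z).congr_deriv ?_
  have e : ∀ d, conformalField l w p (z + d) =
      conformalField l w p z + (l • d + w • quarterTurn d) :=
    fun d => by simp only [conformalField, map_add]; module
  rw [e, hz, zero_add]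

/-! ### Domains whose boundary is saturated -/

/-- If a connected set `F` is either contained in the boundary of an open set or disjoint from it,
then it is contained in the open set as soon as it meets it: it cannot leave it without crossing
the boundary. -/
lemma mem_of_saturated_frontier {X : Type*} [TopologicalSpace X] {Ω : Set X} (hΩ : IsOpen Ω)
    {F : Set X} (hF : IsPreconnected F) (hsat : ∀ x ∈ F, ∀ y ∈ F, x ∈ frontier Ω → y ∈ frontier Ω)
    {x y : X} (hx : x ∈ F) (hy : y ∈ F) (hxΩ : x ∈ Ω) : y ∈ Ω := by
  refine hF.subset_of_closure_inter_subset hΩ ⟨x, hx, hxΩ⟩ ?_ hy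
  rintro z ⟨hz, hzF⟩
  by_contra hzΩ
  have h1 : z ∈ frontier Ω := by rw [hΩ.frontier_eq]; exact ⟨hz, hzΩ⟩
  have h2 := hsat z hzF x hx h1
  rw [hΩ.frontier_eq] at h2
  exact h2.2 hxΩ

lemma isOpen_interval_cases {I : Set ℝ} (ho : IsOpen I) (hc : IsPreconnected I)
    (hn : I.Nonempty) :
    (∃ a b, a < b ∧ I = Ioo a b) ∨ (∃ a, I = Ioi a) ∨ (∃ a, I = Iio a) ∨ I = univ := by
  have hmem := hc.mem_intervals
  have hint := ho.interior_eq
  simp only [mem_insert_iff, mem_singleton_iff] at hmem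
  rcases hmem with h | h | h | h | h | h | h | h | h | h
  · have h' : I = Ioo (sInf I) (sSup I) := by
      conv_lhs => rw [← hint, h, interior_Icc]
    exact Or.inl ⟨_, _, nonempty_Ioo.1 (h' ▸ hn), h'⟩
  · have h' : I = Ioo (sInf I) (sSup I) := by
      conv_lhs => rw [← hint, h, interior_Ico]
    exact Or.inl ⟨_, _, nonempty_Ioo.1 (h' ▸ hn), h'⟩
  · have h' : I = Ioo (sInf I) (sSup I) := by
      conv_lhs => rw [← hint, h, interior_Ioc]
    exact Or.inl ⟨_, _, nonempty_Ioo.1 (h' ▸ hn), h'⟩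
  · exact Or.inl ⟨_, _, nonempty_Ioo.1 (h ▸ hn), h⟩
  · refine Or.inr (Or.inl ⟨sInf I, ?_⟩)
    conv_lhs => rw [← hint, h, interior_Ici]
  · exact Or.inr (Or.inl ⟨_, h⟩)
  · refine Or.inr (Or.inr (Or.inl ⟨sSup I, ?_⟩))
    conv_lhs => rw [← hint, h, interior_Iic]
  · exact Or.inr (Or.inr (Or.inl ⟨_, h⟩))
  · exact Or.inr (Or.inr (Or.inr h))
  · exact absurd h hn.ne_empty

lemma norm_quarterTurn (x : Space 2) : ‖quarterTurn x‖ = ‖x‖ := by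
  have h : ‖quarterTurn x‖ ^ 2 = ‖x‖ ^ 2 := by
    simp only [norm_sq_eq_coord, quarterTurn_zero_coord, quarterTurn_one_coord]; ring
  exact (pow_left_inj₀ (norm_nonneg _) (norm_nonneg _) two_ne_zero).1 h

/-- A vector orthogonal to `quarterTurn p` is a multiple of `p`. -/
lemma eq_smul_of_inner_quarterTurn {p d : Space 2} (hp : p ≠ 0)
    (h : inner ℝ (quarterTurn p) d = 0) : d = (inner ℝ p d / ‖p‖ ^ 2) • p := by
  have hp' : p 0 ^ 2 + p 1 ^ 2 ≠ 0 := by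
    rw [← norm_sq_eq_coord]; simpa using hp
  rw [inner_eq_coord, quarterTurn_zero_coord, quarterTurn_one_coord] at h
  rw [norm_sq_eq_coord, inner_eq_coord]
  ext i; fin_cases i
  · simp only [Fin.zero_eta, PiLp.smul_apply, smul_eq_mul]
    field_simp
    linear_combination (-p 1) * h
  · simp only [Fin.mk_one, PiLp.smul_apply, smul_eq_mul]
    field_simp
    linear_combination p 0 * h

/-- A domain whose boundary is invariant under the translations along a fixed direction is a
half-plane or a slab. -/
theorem isHalfPlane_or_isSlab_of_translation {Ω : Set (Space 2)} (hΩ : IsOpen Ω)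
    (hΩc : IsConnected Ω) (hfr : (frontier Ω).Nonempty) {p : Space 2} (hp : p ≠ 0)
    (hinv : ∀ x ∈ frontier Ω, ∀ s : ℝ, x + s • p ∈ frontier Ω) : IsHalfPlane Ω ∨ IsSlab Ω := by
  have hp0 : ‖p‖ ≠ 0 := norm_ne_zero_iff.2 hp
  set n : Space 2 := ‖p‖⁻¹ • quarterTurn p with hn
  have hn1 : ‖n‖ = 1 := by
    rw [hn, norm_smul, norm_inv, norm_norm, norm_quarterTurn, inv_mul_cancel₀ hp0]
  have hnn : inner ℝ n n = 1 := by rw [real_inner_self_eq_norm_sq, hn1, one_pow]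
  have hsat : ∀ x y : Space 2, inner ℝ n x = inner ℝ n y → x ∈ Ω → y ∈ Ω := by
    intro x y hxy hx
    refine mem_of_saturated_frontier hΩ (F := {z | inner ℝ n z = inner ℝ n x}) ?_ ?_ rfl
      hxy.symm hx
    · have hcv : Convex ℝ {z : Space 2 | inner ℝ n z = inner ℝ n x} :=
        convex_hyperplane (innerSL ℝ n).toLinearMap.isLinear _
      exact hcv.isPreconnected
    · intro a ha b hb haf
      have h1 : inner ℝ n (b - a) = 0 := by
        rw [inner_sub_right, show inner ℝ n b = _ from hb, show inner ℝ n a = _ from ha, sub_self]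
      rw [hn, inner_smul_left, conj_trivial] at h1
      have h2 := eq_smul_of_inner_quarterTurn hp
        ((mul_eq_zero.1 h1).resolve_left (inv_ne_zero hp0))
      have h3 := hinv a haf (inner ℝ p (b - a) / ‖p‖ ^ 2)
      rwa [← h2, add_sub_cancel] at h3
  set I : Set ℝ := {r | r • n ∈ Ω} with hI
  have hΩI : ∀ x, x ∈ Ω ↔ inner ℝ n x ∈ I := by
    intro x
    have e : inner ℝ n x = inner ℝ n ((inner ℝ n x : ℝ) • n) := by
      rw [inner_smul_right, hnn, mul_one]
    exact ⟨hsat _ _ e, hsat _ _ e.symm⟩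
  have hIo : IsOpen I := hΩ.preimage (by fun_prop : Continuous fun r : ℝ => r • n)
  have hII : I = (fun x => inner ℝ n x) '' Ω := by
    ext r
    refine ⟨fun hr => ⟨r • n, hr, by simp only [inner_smul_right, hnn, mul_one]⟩, ?_⟩
    rintro ⟨x, hx, rfl⟩
    exact (hΩI x).1 hx
  have hIc : IsPreconnected I := by
    rw [hII]; exact hΩc.isPreconnected.image _ (by fun_prop)
  have hIn : I.Nonempty := by rw [hII]; exact hΩc.nonempty.image _
  rcases isOpen_interval_cases hIo hIc hIn with ⟨a, b, hab, h⟩ | ⟨a, h⟩ | ⟨a, h⟩ | h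
  · exact Or.inr ⟨n, a, b, hn1, hab, by ext x; rw [hΩI, h]; rfl⟩
  · exact Or.inl ⟨n, a, hn1, by ext x; rw [hΩI, h]; rfl⟩
  · refine Or.inl ⟨-n, -a, by rw [norm_neg, hn1], ?_⟩
    ext x
    rw [hΩI, h]
    simp
  · have : Ω = univ := by ext x; rw [hΩI, h]; simp
    rw [this, frontier_univ] at hfr
    exact absurd hfr not_nonempty_empty

/-- A domain whose boundary is invariant under the rotations around a point outside the boundary
is a disk, the complement of a disk or an annulus. -/
theorem isDisk_or_isDiskComplement_or_isAnnulus_of_rotation {Ω : Set (Space 2)} (hΩ : IsOpen Ω)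
    (hΩc : IsConnected Ω) (hfr : (frontier Ω).Nonempty) {z : Space 2} (hz : z ∉ frontier Ω)
    (hinv : ∀ x ∈ frontier Ω, ∀ y, dist y z = dist x z → y ∈ frontier Ω) :
    IsDisk Ω z ∨ IsDiskComplement Ω z ∨ IsAnnulus Ω z := by
  have hsat : ∀ x y : Space 2, dist x z = dist y z → x ∈ Ω → y ∈ Ω := by
    intro x y hxy hx
    refine mem_of_saturated_frontier hΩ (F := Metric.sphere z (dist x z)) ?_ ?_ rfl
      hxy.symm hx
    · refine isPreconnected_sphere ?_ _ _
      rw [← Module.finrank_eq_rank]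
      simp
    · intro a ha b hb haf
      exact hinv a haf b (hb.trans (Eq.symm ha))
  set e : Space 2 := EuclideanSpace.single 0 1 with he
  have he1 : ‖e‖ = 1 := by simp [he]
  set K : Set ℝ := {r | z + r • e ∈ Ω} with hK
  have hdist : ∀ r : ℝ, dist (z + r • e) z = |r| := fun r => by
    rw [dist_eq_norm, add_sub_cancel_left, norm_smul, he1, mul_one, Real.norm_eq_abs]
  have hΩK : ∀ x, x ∈ Ω ↔ dist x z ∈ K := by
    intro x
    have h : dist x z = dist (z + dist x z • e) z := by rw [hdist, abs_of_nonneg dist_nonneg]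
    exact ⟨hsat _ _ h, hsat _ _ h.symm⟩
  have hKo : IsOpen K := hΩ.preimage (by fun_prop : Continuous fun r : ℝ => z + r • e)
  have hKneg : ∀ r ∈ K, -r ∈ K := fun r hr => hsat _ _ (by rw [hdist, hdist, abs_neg]) hr
  set I : Set ℝ := (fun x => dist x z) '' Ω with hI
  have hIc : IsPreconnected I := hΩc.isPreconnected.image _ (by fun_prop)
  have hIn : I.Nonempty := hΩc.nonempty.image _
  have hIK : I = K ∩ Ici 0 := by
    ext r
    constructor
    · rintro ⟨x, hx, rfl⟩
      exact ⟨(hΩK x).1 hx, dist_nonneg⟩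
    · rintro ⟨hr, hr0⟩
      exact ⟨z + r • e, hr, by simp only [hdist]; exact abs_of_nonneg hr0⟩
  have huniv : Ω ≠ univ := by
    rintro rfl
    rw [frontier_univ] at hfr
    exact not_nonempty_empty hfr
  by_cases hzΩ : z ∈ Ω
  · left
    have h0 : (0 : ℝ) ∈ K := by simpa [hK] using hzΩ
    have hKI : K = I ∪ (fun r => -r) '' I := by
      rw [hIK]
      ext r
      constructor
      · intro hr
        rcases le_total 0 r with h | h
        · exact Or.inl ⟨hr, h⟩
        · exact Or.inr ⟨-r, ⟨hKneg r hr, neg_nonneg.2 h⟩, neg_neg r⟩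
      · rintro (⟨hr, -⟩ | ⟨s, ⟨hs, -⟩, rfl⟩)
        · exact hr
        · exact hKneg s hs
    have h0I : (0 : ℝ) ∈ I := by rw [hIK]; exact ⟨h0, mem_Ici.2 le_rfl⟩
    have hKc : IsPreconnected K := by
      rw [hKI]
      exact hIc.union 0 h0I ⟨0, h0I, neg_zero⟩ (hIc.image _ continuous_neg.continuousOn)
    rcases isOpen_interval_cases hKo hKc ⟨0, h0⟩ with ⟨a, b, -, h⟩ | ⟨a, h⟩ | ⟨a, h⟩ | h
    · have hb : 0 < b := by rw [h] at h0; exact h0.2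
      have hab : a ≤ -b := by
        by_contra! hlt
        have ha0 : a < 0 := by rw [h] at h0; exact h0.1
        -- the point `-a` belongs to `K` whereas `a` does not
        have : -a ∈ K := by rw [h]; exact ⟨by linarith, by linarith⟩
        have := hKneg _ this
        rw [neg_neg, h] at this
        exact lt_irrefl _ this.1
      refine ⟨b, hb, ?_⟩
      ext x
      rw [hΩK, h]
      refine ⟨fun hx => hx.2, fun hx => ⟨?_, hx⟩⟩
      have := dist_nonneg (x := x) (y := z)
      have hx' : dist x z < b := hx
      linarith
    · exfalso
      apply huniv
      have h0' : a < 0 := by rw [h] at h0; exact h0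
      ext x
      rw [hΩK, h]
      simpa using h0'.trans_le dist_nonneg
    · exfalso
      have h0' : 0 < a := by rw [h] at h0; exact h0
      have h1 : -a ∈ K := by rw [h]; simp only [mem_Iio]; linarith
      have := hKneg _ h1
      rw [neg_neg, h] at this
      exact lt_irrefl a this
    · exact absurd (by ext x; rw [hΩK, h]; simp) huniv
  · right
    have hzc : z ∉ closure Ω := fun h => hz (by rw [hΩ.frontier_eq]; exact ⟨h, hzΩ⟩)
    obtain ⟨ε, hε, hball⟩ := Metric.isOpen_iff.1 isClosed_closure.isOpen_compl z hzc
    have hlow : ∀ r ∈ I, ε ≤ r := by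
      rintro r ⟨x, hx, rfl⟩
      by_contra! hlt
      exact hball hlt (subset_closure hx)
    have hIK' : I = K ∩ Ioi 0 := by
      ext r
      constructor
      · intro hr
        have h1 := hr
        rw [hIK] at h1
        exact ⟨h1.1, lt_of_lt_of_le hε (hlow r hr)⟩
      · rintro ⟨hr, hr0⟩
        rw [hIK]
        exact ⟨hr, mem_Ici.2 (le_of_lt hr0)⟩
    have hIo : IsOpen I := by rw [hIK']; exact hKo.inter isOpen_Ioi
    have hΩI : ∀ x, x ∈ Ω ↔ dist x z ∈ I := by
      intro x
      rw [hΩK, hIK]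
      exact ⟨fun h => ⟨h, dist_nonneg⟩, fun h => h.1⟩
    rcases isOpen_interval_cases hIo hIc hIn with ⟨a, b, hab, h⟩ | ⟨a, h⟩ | ⟨a, h⟩ | h
    · right
      refine ⟨a, b, ?_, hab, by ext x; rw [hΩI, h]; rfl⟩
      by_contra! ha
      have h1 : ε ≤ (a + b) / 2 := hlow _ (by rw [h]; constructor <;> linarith)
      have h2 : ε ≤ (a + ε) / 2 := hlow _ (by rw [h]; constructor <;> linarith)
      linarith
    · left
      refine ⟨a, ?_, by ext x; rw [hΩI, h]; rfl⟩
      by_contra! ha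
      have h1 : ε / 2 ∈ I := by rw [h]; simp only [mem_Ioi]; linarith
      linarith [hlow _ h1]
    · have h1 : min (a - 1) 0 ∈ I := by
        rw [h]
        exact mem_Iio.2 ((min_le_left _ _).trans_lt (by linarith))
      linarith [hlow _ h1, min_le_right (a - 1) 0]
    · have h1 : (0 : ℝ) ∈ I := by rw [h]; trivial
      linarith [hlow _ h1]

/-! ### Classification of the domains with a tangent conformal field -/

lemma conformalField_eq_zero_center {l w : ℝ} (h : l ≠ 0 ∨ w ≠ 0) (p : Space 2) :
    ∃ z, conformalField l w p z = 0 := by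
  have hd : l ^ 2 + w ^ 2 ≠ 0 := by
    rcases h with h | h <;> positivity
  refine ⟨(l ^ 2 + w ^ 2)⁻¹ • (w • quarterTurn p - l • p), ?_⟩
  have h1 : conformalField l w p ((l ^ 2 + w ^ 2)⁻¹ • (w • quarterTurn p - l • p)) =
      p - ((l ^ 2 + w ^ 2)⁻¹ * (l ^ 2 + w ^ 2)) • p := by
    simp only [conformalField, map_smul, map_sub, quarterTurn_quarterTurn]
    module
  rw [h1, inv_mul_cancel₀ hd, one_smul, sub_self]

lemma eq_of_orthogonal_frame {n d : Space 2} (hd : d ≠ 0) (h1 : inner ℝ n d = 0)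
    (h2 : inner ℝ n (quarterTurn d) = 0) : n = 0 := by
  have h3 := eq_smul_of_inner_quarterTurn hd (by rwa [real_inner_comm])
  rw [h3, real_inner_comm, h1, zero_div, zero_smul]

/-- At the singular point of a field that is not purely rotational, the boundary contains a
logarithmic spiral or a ray, whose tangent direction has to exist; this only leaves rays, and the
boundary is a straight line. -/
lemma IsTangentField.frontier_translation_of_dilation {Ω : Set (Space 2)}
    (hreg : HasRegularBoundary Ω) {l w : ℝ} (hl : l ≠ 0) {p : Space 2}
    (hV : IsTangentField Ω (conformalField l w p)) :
    ∃ τ : Space 2, τ ≠ 0 ∧ ∀ x ∈ frontier Ω, ∀ s : ℝ, x + s • τ ∈ frontier Ω := by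
  obtain ⟨z, hz⟩ := conformalField_eq_zero_center (Or.inl hl : l ≠ 0 ∨ w ≠ 0) p
  -- the spirals issued from `x` return to the direction of angle `θ` arbitrarily close to `z`
  have hret : ∀ x ∈ frontier Ω, ∀ θ : ℝ, (w = 0 → θ = 0) → ∃ᶠ r in 𝓝[>] (0 : ℝ),
      z + r • (Real.cos θ • (x - z) + Real.sin θ • quarterTurn (x - z)) ∈ frontier Ω := by
    intro x hx θ hθ
    have hseq : ∃ σ : ℕ → ℝ, Tendsto (fun k => l * σ k) atTop atBot ∧
        ∀ k, Real.cos (w * σ k) = Real.cos θ ∧ Real.sin (w * σ k) = Real.sin θ := by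
      rcases eq_or_ne w 0 with rfl | hw
      · refine ⟨fun k => -(k : ℝ) / l, ?_, fun k => by simp [hθ rfl]⟩
        have : (fun k : ℕ => l * (-(k : ℝ) / l)) = fun k : ℕ => -(k : ℝ) := by
          ext k; field_simp
        rw [this]
        exact tendsto_neg_atTop_atBot.comp tendsto_natCast_atTop_atTop
      · obtain ⟨j, hj⟩ : ∃ j : ℤ, l / w * j < 0 := by
          rcases lt_or_gt_of_ne (div_ne_zero hl hw) with h | h
          · exact ⟨1, by simpa using h⟩
          · exact ⟨-1, by simpa using h⟩
        refine ⟨fun k => (θ + ((j * k : ℤ) : ℝ) * (2 * Real.pi)) / w, ?_, fun k => ?_⟩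
        · have : (fun k : ℕ => l * ((θ + ((j * k : ℤ) : ℝ) * (2 * Real.pi)) / w)) =
              fun k : ℕ => l / w * θ + (l / w * j * (2 * Real.pi)) * (k : ℝ) := by
            ext k; push_cast; ring
          rw [this]
          refine tendsto_atBot_add_const_left _ _ ?_
          exact tendsto_natCast_atTop_atTop.const_mul_atTop_of_neg
            (mul_neg_of_neg_of_pos hj Real.two_pi_pos)
        · rw [mul_div_cancel₀ _ hw]
          exact ⟨Real.cos_add_int_mul_two_pi _ _, Real.sin_add_int_mul_two_pi _ _⟩
    obtain ⟨σ, hσ, hcs⟩ := hseq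
    have ht : Tendsto (fun k => Real.exp (l * σ k)) atTop (𝓝[>] 0) :=
      tendsto_nhdsWithin_iff.2 ⟨Real.tendsto_exp_atBot.comp hσ,
        Eventually.of_forall fun k => Real.exp_pos _⟩
    refine ht.frequently (Eventually.frequently (Eventually.of_forall fun k => ?_))
    have := hV.spiral_mem hreg hz hx (σ k)
    rwa [(hcs k).1, (hcs k).2] at this
  have hray : ∀ d : Space 2, HasDerivAt (fun r : ℝ => z + r • d) d 0 := fun d => by
    have h := ((hasDerivAt_id (0 : ℝ)).smul_const d).const_add z
    rwa [one_smul] at h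
  have hzf : z ∈ frontier Ω := by
    obtain ⟨x, hx⟩ := hreg.1
    have h1 : Tendsto (fun r : ℝ => z + r • (Real.cos 0 • (x - z)
        + Real.sin 0 • quarterTurn (x - z))) (𝓝[>] 0) (𝓝 z) := by
      have := ((hray (Real.cos 0 • (x - z)
        + Real.sin 0 • quarterTurn (x - z))).continuousAt.tendsto).mono_left
        (nhdsWithin_le_nhds (s := Ioi 0))
      simpa using this
    exact isClosed_frontier.mem_of_frequently_of_tendsto (hret x hx 0 fun _ => rfl) h1
  obtain ⟨g, hg⟩ := hreg.2 z hzf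
  set n := gradient g z with hn
  have hn0 : n ≠ 0 := hg.2.1
  have horth : ∀ x ∈ frontier Ω, ∀ θ : ℝ, (w = 0 → θ = 0) →
      inner ℝ n (Real.cos θ • (x - z) + Real.sin θ • quarterTurn (x - z)) = 0 := by
    intro x hx θ hθ
    refine hg.inner_eq_zero_of_frequently hzf (hray _) (by simp) ?_
    exact (hret x hx θ hθ).filter_mono (nhdsWithin_mono _ fun r (hr : 0 < r) => hr.ne')
  have hline : ∀ x ∈ frontier Ω, inner ℝ n (x - z) = 0 := fun x hx => by
    simpa using horth x hx 0 fun _ => rfl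
  have hJn : inner ℝ n (quarterTurn n) = 0 := by
    simp only [inner_eq_coord, quarterTurn_zero_coord, quarterTurn_one_coord]; ring
  have hJn0 : quarterTurn n ≠ 0 := by
    rw [← norm_ne_zero_iff, norm_quarterTurn]; exact norm_ne_zero_iff.2 hn0
  -- the boundary has points on both sides of `z`
  obtain ⟨δ, hδ, hcross⟩ := hg.exists_crossing hzf (quarterTurn n) one_pos
  have hpt : ∀ η : ℝ, |η| < δ → z + η • quarterTurn n ∈ frontier Ω := by
    intro η hη
    obtain ⟨s, -, hs⟩ := hcross η hη
    have h1 := hline _ hs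
    rw [add_assoc, add_sub_cancel_left, inner_add_right, inner_smul_right, inner_smul_right, hJn,
      mul_zero, add_zero, real_inner_self_eq_norm_sq] at h1
    have h2 : s = 0 := (mul_eq_zero.1 h1).resolve_right (by simpa using hn0)
    rwa [← hn, h2, zero_smul, add_zero] at hs
  have hw : w = 0 := by
    by_contra hw
    have hx := hpt (δ / 2) (by rw [abs_of_pos (half_pos hδ)]; linarith)
    have h1 := horth _ hx 0 fun h => absurd h hw
    have h2 := horth _ hx (Real.pi / 2) fun h => absurd h hw
    simp only [Real.cos_zero, Real.sin_zero, one_smul, zero_smul, add_zero, Real.cos_pi_div_two,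
      Real.sin_pi_div_two, zero_add] at h1 h2
    refine hn0 (eq_of_orthogonal_frame ?_ h1 h2)
    rw [add_sub_cancel_left]
    exact smul_ne_zero (half_pos hδ).ne' hJn0
  subst hw
  have hall : ∀ r : ℝ, z + r • quarterTurn n ∈ frontier Ω := by
    intro r
    rcases eq_or_ne r 0 with rfl | hr
    · simpa using hzf
    have hr' : 0 < |r| := abs_pos.2 hr
    set η : ℝ := δ / 2 * (r / |r|) with hη
    have hηδ : |η| < δ := by
      rw [hη, abs_mul, abs_div r, abs_abs, div_self hr'.ne', mul_one, abs_of_pos (half_pos hδ)]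
      linarith
    have h1 := hV.spiral_mem hreg hz (hpt η hηδ) (Real.log (2 * |r| / δ) / l)
    rw [mul_div_cancel₀ _ hl, Real.exp_log (by positivity)] at h1
    simp only [zero_mul, Real.cos_zero, Real.sin_zero, zero_smul, add_zero,
      add_sub_cancel_left, smul_smul] at h1
    convert h1 using 3
    rw [hη]
    field_simp
  refine ⟨quarterTurn n, hJn0, fun x hx s => ?_⟩
  have h1 : inner ℝ (quarterTurn (quarterTurn n)) (x - z) = 0 := by
    rw [quarterTurn_quarterTurn, inner_neg_left, hline x hx, neg_zero]
  have h2 := eq_smul_of_inner_quarterTurn hJn0 h1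
  rw [← sub_add_cancel x z, h2, add_comm _ z, add_assoc, ← add_smul]
  exact hall _

lemma exists_rotateAbout_eq {z x y : Space 2} (h : dist y z = dist x z) :
    ∃ θ, rotateAbout z θ x = y := by
  rcases eq_or_ne x z with rfl | hxz
  · rw [dist_self, dist_eq_zero] at h
    exact ⟨0, by simp [rotateAbout, h]⟩
  set d := x - z with hd
  set e := y - z with he
  have hd0 : d ≠ 0 := sub_ne_zero.2 hxz
  have hN : d 0 ^ 2 + d 1 ^ 2 ≠ 0 := by rw [← norm_sq_eq_coord]; simpa using hd0
  have hN' : e 0 ^ 2 + e 1 ^ 2 = d 0 ^ 2 + d 1 ^ 2 := by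
    rw [dist_eq_norm, dist_eq_norm] at h
    rw [← norm_sq_eq_coord, ← norm_sq_eq_coord, h]
  set c := (d 0 * e 0 + d 1 * e 1) / (d 0 ^ 2 + d 1 ^ 2) with hc
  set s := (d 0 * e 1 - d 1 * e 0) / (d 0 ^ 2 + d 1 ^ 2) with hs
  have hcs : c ^ 2 + s ^ 2 = 1 := by
    rw [hc, hs, div_pow, div_pow, ← add_div, div_eq_one_iff_eq (pow_ne_zero 2 hN)]
    linear_combination (d 0 ^ 2 + d 1 ^ 2) * hN'
  obtain ⟨θ, hθ⟩ := (Complex.norm_eq_one_iff (⟨c, s⟩ : ℂ)).1 (by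
    rw [Complex.norm_def, Complex.normSq_mk, Real.sqrt_eq_one]
    linarith)
  rw [Complex.exp_mul_I] at hθ
  have hcθ : Real.cos θ = c := by
    simpa [Complex.cos_ofReal_re, Complex.sin_ofReal_im] using congrArg Complex.re hθ
  have hsθ : Real.sin θ = s := by
    simpa [Complex.cos_ofReal_im, Complex.sin_ofReal_re] using congrArg Complex.im hθ
  refine ⟨θ, ?_⟩
  have hde : c • d + s • quarterTurn d = e := by
    ext i; fin_cases i
    · simp [hc, hs]; field_simp; ring
    · simp [hc, hs]; field_simp; ring
  rw [rotateAbout, hcθ, hsθ, ← hd, hde, he, add_sub_cancel]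

/-- A domain with a regular boundary to which a nonzero conformal affine field is tangent is one
of the special domains. -/
theorem special_domain_of_isTangentField {Ω : Set (Space 2)} (hΩ : IsOpen Ω)
    (hΩc : IsConnected Ω) (hreg : HasRegularBoundary Ω) {l w : ℝ} {p : Space 2}
    (hV : IsTangentField Ω (conformalField l w p)) (hne : ¬ (l = 0 ∧ w = 0 ∧ p = 0)) :
    IsHalfPlane Ω ∨ IsSlab Ω ∨ ∃ y, IsDisk Ω y ∨ IsDiskComplement Ω y ∨ IsAnnulus Ω y := by
  rcases eq_or_ne l 0 with rfl | hl
  swap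
  · obtain ⟨τ, hτ, hinv⟩ := hV.frontier_translation_of_dilation hreg hl
    exact (isHalfPlane_or_isSlab_of_translation hΩ hΩc hreg.1 hτ hinv).imp id Or.inl
  rcases eq_or_ne w 0 with rfl | hw
  · have hp : p ≠ 0 := fun h => hne ⟨rfl, rfl, h⟩
    exact (isHalfPlane_or_isSlab_of_translation hΩ hΩc hreg.1 hp
      fun x hx s => hV.add_smul_mem hreg hx s).imp id Or.inl
  obtain ⟨z, hz⟩ := conformalField_eq_zero_center (Or.inr hw : (0 : ℝ) ≠ 0 ∨ w ≠ 0) p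
  have hrot : ∀ x ∈ frontier Ω, ∀ y, dist y z = dist x z → y ∈ frontier Ω := by
    intro x hx y hxy
    obtain ⟨θ, rfl⟩ := exists_rotateAbout_eq hxy
    have := hV.spiral_mem hreg hz hx (θ / w)
    rwa [zero_mul, Real.exp_zero, one_smul, mul_div_cancel₀ _ hw] at this
  refine Or.inr (Or.inr ⟨z, isDisk_or_isDiskComplement_or_isAnnulus_of_rotation hΩ hΩc hreg.1
    (fun hzf => ?_) hrot⟩)
  -- if `z` were on the boundary, so would be small circles around it
  obtain ⟨g, hg⟩ := hreg.2 z hzf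
  set n := gradient g z with hn
  have hn0 : n ≠ 0 := hg.2.1
  have hnorm : ‖n‖ ≠ 0 := norm_ne_zero_iff.2 hn0
  have hJn : inner ℝ (quarterTurn n) n = 0 := by
    simp only [inner_eq_coord, quarterTurn_zero_coord, quarterTurn_one_coord]; ring
  have hfreq : ∃ᶠ r in 𝓝[≠] (0 : ℝ), z + r • n ∈ frontier Ω := by
    rw [Filter.frequently_iff]
    intro U hU
    obtain ⟨ε, hε, hεU⟩ := Metric.mem_nhdsWithin_iff.1 hU
    obtain ⟨δ, hδ, hcross⟩ := hg.exists_crossing hzf (quarterTurn n) (half_pos hε)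
    set η : ℝ := min (δ / 2) (ε / 2) with hη
    have hη0 : 0 < η := lt_min (half_pos hδ) (half_pos hε)
    obtain ⟨s, hsε, hs⟩ := hcross η (by
      rw [abs_of_pos hη0]; exact (min_le_left _ _).trans_lt (half_lt_self hδ))
    set v : Space 2 := s • n + η • quarterTurn n with hv
    have hv0 : v ≠ 0 := by
      intro h0
      have h1 := congrArg (inner ℝ (quarterTurn n)) h0
      rw [hv, inner_add_right, inner_smul_right, inner_smul_right, hJn, inner_zero_right,
        real_inner_self_eq_norm_sq, norm_quarterTurn, mul_zero, zero_add] at h1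
      exact mul_ne_zero hη0.ne' (pow_ne_zero 2 hnorm) h1
    have hvle : ‖v‖ < ε * ‖n‖ := by
      calc ‖v‖ ≤ ‖s • n‖ + ‖η • quarterTurn n‖ := norm_add_le _ _
        _ = (|s| + η) * ‖n‖ := by
          rw [norm_smul, norm_smul, norm_quarterTurn, Real.norm_eq_abs, Real.norm_eq_abs,
            abs_of_pos hη0]; ring
        _ < ε * ‖n‖ := by
          have : η ≤ ε / 2 := min_le_right _ _
          have := norm_pos_iff.2 hn0
          gcongr
          linarith
    have hr0 : 0 < ‖v‖ / ‖n‖ := div_pos (norm_pos_iff.2 hv0) (norm_pos_iff.2 hn0)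
    refine ⟨‖v‖ / ‖n‖, hεU ⟨?_, hr0.ne'⟩, ?_⟩
    · rw [Metric.mem_ball, dist_zero_right, Real.norm_eq_abs, abs_of_pos hr0,
        div_lt_iff₀ (norm_pos_iff.2 hn0)]
      exact hvle
    · refine hrot _ hs _ ?_
      rw [dist_eq_norm, dist_eq_norm, add_sub_cancel_left, add_assoc, add_sub_cancel_left,
        norm_smul, Real.norm_eq_abs, abs_of_pos hr0, div_mul_cancel₀ _ hnorm]
  have hray : HasDerivAt (fun r : ℝ => z + r • n) n 0 := by
    have h := ((hasDerivAt_id (0 : ℝ)).smul_const n).const_add z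
    rwa [one_smul] at h
  exact hn0 (inner_self_eq_zero.1
    (hg.inner_eq_zero_of_frequently hzf hray (by simp) hfreq))

/-! ### Tangent fields on lines and circles -/

/-- On a curve contained in the boundary, being orthogonal to all the unit normals means being
tangent to the curve. -/
lemma forall_unitNormal_iff {Ω : Set (Space 2)} (hreg : HasRegularBoundary Ω) {x d V : Space 2}
    (hx : x ∈ frontier Ω) (hd : d ≠ 0) {c : ℝ → Space 2} (hc : HasDerivAt c d 0) (hc0 : c 0 = x)
    (hcΩ : ∀ s, c s ∈ frontier Ω) :
    (∀ n, IsUnitNormal Ω x n → inner ℝ n V = 0) ↔ inner ℝ (quarterTurn d) V = 0 := by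
  have key : ∀ n, IsUnitNormal Ω x n → ∃ k : ℝ, k ≠ 0 ∧ n = k • quarterTurn d := by
    intro n hn
    have h1 := hn.inner_eq_zero_of_frequently hx hc hc0
      (Eventually.frequently (Eventually.of_forall hcΩ))
    have hd' : quarterTurn d ≠ 0 := by
      rw [← norm_ne_zero_iff, norm_quarterTurn]; exact norm_ne_zero_iff.2 hd
    have h2 := eq_smul_of_inner_quarterTurn (d := n) hd' (by
      rw [quarterTurn_quarterTurn, inner_neg_left, real_inner_comm, h1, neg_zero])
    refine ⟨_, ?_, h2⟩
    intro h0
    rw [h0, zero_smul] at h2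
    have := hn.1
    rw [h2, norm_zero] at this
    exact zero_ne_one this
  constructor
  · intro h
    obtain ⟨g, hg⟩ := hreg.2 x hx
    obtain ⟨k, hk, e⟩ := key _ hg.isUnitNormal
    have h1 := h _ hg.isUnitNormal
    rw [e, inner_smul_left, conj_trivial] at h1
    exact (mul_eq_zero.1 h1).resolve_left hk
  · intro h n hn
    obtain ⟨k, -, rfl⟩ := key n hn
    rw [inner_smul_left, h, mul_zero]

/-- A conformal affine field is tangent to a straight line contained in the boundary exactly when
it has no rotational part and its normal component, then constant along the line, vanishes. -/
lemma line_tangent_iff {Ω : Set (Space 2)} (hreg : HasRegularBoundary Ω) {n τ : Space 2} {c : ℝ}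
    (hn : ‖n‖ = 1) (hτ : ‖τ‖ = 1) (hnτ : inner ℝ n τ = 0) (hline : lineAt c n τ ⊆ frontier Ω)
    (l w : ℝ) (p : Space 2) :
    (∀ x ∈ lineAt c n τ, ∀ n', IsUnitNormal Ω x n' → inner ℝ n' (conformalField l w p x) = 0) ↔
      w = 0 ∧ inner ℝ n p = -(l * c) := by
  have hτ0 : τ ≠ 0 := by rintro rfl; simp at hτ
  have hn0 : n ≠ 0 := by rintro rfl; simp at hn
  obtain ⟨κ, hκ, hJ⟩ : ∃ κ : ℝ, κ ≠ 0 ∧ quarterTurn τ = κ • n := by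
    have h := eq_smul_of_inner_quarterTurn (p := n) (d := quarterTurn τ) hn0 (by
      rw [← hnτ]
      simp only [inner_eq_coord, quarterTurn_zero_coord, quarterTurn_one_coord]; ring)
    refine ⟨_, fun h0 => ?_, h⟩
    have h1 := norm_quarterTurn τ
    rw [h, h0, zero_smul, norm_zero, hτ] at h1
    exact zero_ne_one h1
  have hpt : ∀ s : ℝ, (∀ n', IsUnitNormal Ω (c • n + s • τ) n' →
      inner ℝ n' (conformalField l w p (c • n + s • τ)) = 0) ↔
      l * c + w * (s * κ) + inner ℝ n p = 0 := by
    intro s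
    have hmem : ∀ r : ℝ, c • n + s • τ + r • τ ∈ frontier Ω := fun r =>
      hline ⟨s + r, by rw [add_smul, add_assoc]⟩
    have hd : HasDerivAt (fun r : ℝ => c • n + s • τ + r • τ) τ 0 := by
      have h := ((hasDerivAt_id (0 : ℝ)).smul_const τ).const_add (c • n + s • τ)
      rwa [one_smul] at h
    rw [forall_unitNormal_iff hreg (by simpa using hmem 0) hτ0 hd (by simp) hmem, hJ,
      inner_smul_left, conj_trivial, mul_eq_zero, or_iff_right hκ]
    have hnJn : inner ℝ n (quarterTurn n) = (0 : ℝ) := by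
      simp only [inner_eq_coord, quarterTurn_zero_coord, quarterTurn_one_coord]; ring
    have e : inner ℝ n (conformalField l w p (c • n + s • τ)) =
        l * c + w * (s * κ) + inner ℝ n p := by
      simp only [conformalField, map_add, map_smul, inner_add_right, inner_smul_right, hnτ, hnJn,
        hJ, real_inner_self_eq_norm_sq, hn]
      ring
    rw [e]
  constructor
  · intro h
    have h0 := (hpt 0).1 (h _ ⟨0, rfl⟩)
    have h1 := (hpt 1).1 (h _ ⟨1, rfl⟩)
    rw [zero_mul, mul_zero, add_zero] at h0
    have hw : w * κ = 0 := by linarith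
    exact ⟨(mul_eq_zero.1 hw).resolve_right hκ, by linarith⟩
  · rintro ⟨rfl, h⟩ x ⟨s, rfl⟩
    refine (hpt s).2 ?_
    rw [h]; ring

lemma eq_of_inner_frame {n τ : Space 2} (hn : ‖n‖ = 1) (hτ : ‖τ‖ = 1) (hnτ : inner ℝ n τ = 0)
    (p : Space 2) : p = (inner ℝ n p : ℝ) • n + (inner ℝ τ p : ℝ) • τ := by
  have hτ0 : τ ≠ 0 := by rintro rfl; simp at hτ
  refine sub_eq_zero.1 (eq_of_orthogonal_frame hτ0 ?_ ?_)
  · rw [inner_sub_left, inner_add_left, inner_smul_left, inner_smul_left, hnτ,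
      real_inner_self_eq_norm_sq, hτ, real_inner_comm]
    simp
  · have h1 : inner ℝ n n = (1 : ℝ) := by rw [real_inner_self_eq_norm_sq, hn, one_pow]
    have hn0 : n ≠ 0 := by rintro rfl; simp at hn
    have h := eq_smul_of_inner_quarterTurn (p := n) (d := quarterTurn τ) hn0 (by
      rw [← hnτ]
      simp only [inner_eq_coord, quarterTurn_zero_coord, quarterTurn_one_coord]; ring)
    rw [h, inner_smul_right, inner_sub_left, inner_add_left, inner_smul_left, inner_smul_left,
      h1, real_inner_comm n τ, hnτ, real_inner_comm n p]
    simp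

/-- The boundary of a domain invariant under rotations around `y` is a union of circles, and the
conformal affine fields tangent to it are the infinitesimal rotations around `y`. -/
lemma radial_tangent_iff {Ω : Set (Space 2)} (hΩ : IsOpen Ω) (hreg : HasRegularBoundary Ω)
    {y : Space 2} (hsat : ∀ x x' : Space 2, dist x y = dist x' y → x ∈ Ω → x' ∈ Ω)
    (hy : y ∉ frontier Ω) (l w : ℝ) (p : Space 2) :
    IsTangentField Ω (conformalField l w p) ↔ l = 0 ∧ p = -(w • quarterTurn y) := by
  have hdist : ∀ θ x, dist (rotateAbout y θ x) y = dist x y := by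
    intro θ x
    rw [rotateAbout, dist_eq_norm, dist_eq_norm, add_sub_cancel_left]
    refine (pow_left_inj₀ (norm_nonneg _) (norm_nonneg _) two_ne_zero).1 ?_
    simp only [norm_sq_eq_coord, quarterTurn_zero_coord, quarterTurn_one_coord, PiLp.add_apply,
      PiLp.smul_apply, smul_eq_mul]
    linear_combination ((x - y) 0 ^ 2 + (x - y) 1 ^ 2) * Real.sin_sq_add_cos_sq θ
  have hrot : ∀ x ∈ frontier Ω, ∀ θ, rotateAbout y θ x ∈ frontier Ω := by
    intro x hx θ
    rw [hΩ.frontier_eq] at hx ⊢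
    have hcont : Continuous (rotateAbout y θ) := by unfold rotateAbout; fun_prop
    exact ⟨map_mem_closure hcont hx.1 fun x' hx' => hsat _ _ (hdist θ x').symm hx',
      fun h => hx.2 (hsat _ _ (hdist θ x) h)⟩
  have hpt : ∀ x ∈ frontier Ω, (∀ n, IsUnitNormal Ω x n →
      inner ℝ n (conformalField l w p x) = 0) ↔ inner ℝ (x - y) (conformalField l w p x) = 0 := by
    intro x hx
    have hxy : x - y ≠ 0 := sub_ne_zero.2 fun h => hy (h ▸ hx)
    have hd : HasDerivAt (fun θ => rotateAbout y θ x) (quarterTurn (x - y)) 0 := by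
      have h := (((Real.hasDerivAt_cos 0).smul_const (x - y)).add
        ((Real.hasDerivAt_sin 0).smul_const (quarterTurn (x - y)))).const_add y
      refine h.congr_deriv ?_
      simp
    rw [forall_unitNormal_iff hreg hx (by
      rw [← norm_ne_zero_iff, norm_quarterTurn]; exact norm_ne_zero_iff.2 hxy) hd
      (by simp [rotateAbout]) (hrot x hx), quarterTurn_quarterTurn, inner_neg_left, neg_eq_zero]
  constructor
  · intro h
    obtain ⟨x, hx⟩ := hreg.1
    set d := x - y with hdd
    have hd0 : d ≠ 0 := sub_ne_zero.2 fun h => hy (h ▸ hx)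
    have hval : ∀ θ, inner ℝ (Real.cos θ • d + Real.sin θ • quarterTurn d)
        (conformalField l w p (y + (Real.cos θ • d + Real.sin θ • quarterTurn d))) = 0 := by
      intro θ
      have h1 := (hpt _ (hrot x hx θ)).1 (h _ (hrot x hx θ))
      rwa [rotateAbout, add_sub_cancel_left] at h1
    have hexp : ∀ e : Space 2, inner ℝ e (conformalField l w p (y + e)) =
        l * ‖e‖ ^ 2 + inner ℝ e (conformalField l w p y) := by
      intro e
      simp only [conformalField, inner_eq_coord, norm_sq_eq_coord, PiLp.smul_apply,
        PiLp.add_apply, quarterTurn_zero_coord, quarterTurn_one_coord, smul_eq_mul]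
      ring
    -- opposite points of the circle, then a point at a right angle
    have h0 := hval 0
    have h1 := hval Real.pi
    have h2 := hval (Real.pi / 2)
    simp only [Real.cos_zero, Real.sin_zero, Real.cos_pi, Real.sin_pi, Real.cos_pi_div_two,
      Real.sin_pi_div_two, one_smul, zero_smul, add_zero, zero_add, neg_smul] at h0 h1 h2
    rw [hexp] at h0 h1 h2
    rw [norm_neg, inner_neg_left] at h1
    have hl : l = 0 := by
      have : l * ‖d‖ ^ 2 = 0 := by linarith
      exact (mul_eq_zero.1 this).resolve_right (by simpa using hd0)
    subst hl
    rw [zero_mul, zero_add, real_inner_comm] at h0 h2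
    have h3 := eq_of_orthogonal_frame hd0 h0 h2
    refine ⟨rfl, ?_⟩
    rw [conformalField, zero_smul, zero_add] at h3
    exact eq_neg_of_add_eq_zero_right h3
  · rintro ⟨rfl, rfl⟩ x hx
    refine (hpt x hx).2 ?_
    simp only [conformalField, inner_eq_coord, PiLp.smul_apply, PiLp.neg_apply, PiLp.sub_apply,
      PiLp.add_apply, quarterTurn_zero_coord, quarterTurn_one_coord, smul_eq_mul]
    ring

lemma saturated_and_center_notMem_frontier {Ω : Set (Space 2)} {y : Space 2}
    (h : IsDisk Ω y ∨ IsDiskComplement Ω y ∨ IsAnnulus Ω y) :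
    (∀ x x' : Space 2, dist x y = dist x' y → x ∈ Ω → x' ∈ Ω) ∧ y ∉ frontier Ω := by
  have hc : Continuous fun x : Space 2 => dist x y := by fun_prop
  rcases h with ⟨r, hr, rfl⟩ | ⟨r, hr, rfl⟩ | ⟨r₁, r₂, hr, hrr, rfl⟩
  · refine ⟨fun x x' hx hm => ?_, fun hy => ?_⟩
    · simpa [← hx] using hm
    · have := frontier_lt_subset_eq hc continuous_const hy
      simp only [mem_ofPred_eq, dist_self] at this
      exact hr.ne this
  · refine ⟨fun x x' hx hm => ?_, fun hy => ?_⟩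
    · simpa [← hx] using hm
    · have := frontier_lt_subset_eq continuous_const hc hy
      simp only [mem_ofPred_eq, dist_self] at this
      exact hr.ne' this
  · refine ⟨fun x x' hx hm => ?_, fun hy => ?_⟩
    · simpa [← hx] using hm
    · rcases frontier_inter_subset _ _ hy with h | h
      · have := frontier_lt_subset_eq continuous_const hc h.1
        simp only [mem_ofPred_eq, dist_self] at this
        exact hr.ne' this
      · have := frontier_lt_subset_eq hc continuous_const h.2
        simp only [mem_ofPred_eq, dist_self] at this
        exact (hr.trans hrr).ne this

/-- The two boundary lines of a slab are distinct. -/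
lemma IsSlab.line_ne {Ω : Set (Space 2)} (h : IsSlab Ω) {x₁ x₂ : ℝ} {n τ : Space 2}
    (hn : ‖n‖ = 1) (hnτ : inner ℝ n τ = 0)
    (hfr : frontier Ω = lineAt x₁ n τ ∪ lineAt x₂ n τ) : x₁ ≠ x₂ := by
  rintro rfl
  rw [union_self] at hfr
  obtain ⟨n₀, c₁, c₂, hn₀, hc, rfl⟩ := h
  have h00 : inner ℝ n₀ n₀ = (1 : ℝ) := by rw [real_inner_self_eq_norm_sq, hn₀, one_pow]
  have hn₀0 : n₀ ≠ 0 := by rintro rfl; simp at hn₀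
  have hopen : IsOpenMap fun x : Space 2 => (inner ℝ n₀ x : ℝ) := by
    refine (innerSL ℝ n₀).isOpenMap fun r => ⟨r • n₀, ?_⟩
    rw [innerSL_apply_apply, inner_smul_right, h00, mul_one]
  have hfr' : frontier {x : Space 2 | c₁ < inner ℝ n₀ x ∧ inner ℝ n₀ x < c₂} =
      (fun x : Space 2 => (inner ℝ n₀ x : ℝ)) ⁻¹' {c₁, c₂} := by
    rw [← frontier_Ioo hc, hopen.preimage_frontier_eq_frontier_preimage (by fun_prop)]
    rfl
  have hmem : ∀ x : Space 2, inner ℝ n₀ x = c₁ ∨ inner ℝ n₀ x = c₂ → inner ℝ n x = x₁ := by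
    intro x hx
    have h1 : x ∈ lineAt x₁ n τ := by rw [← hfr, hfr']; exact hx
    obtain ⟨s, rfl⟩ := h1
    rw [inner_add_right, inner_smul_right, inner_smul_right, hnτ, real_inner_self_eq_norm_sq, hn]
    ring
  have hJ : inner ℝ n₀ (quarterTurn n₀) = (0 : ℝ) := by
    simp only [inner_eq_coord, quarterTurn_zero_coord, quarterTurn_one_coord]; ring
  have e1 := hmem (c₁ • n₀) (Or.inl (by rw [inner_smul_right, h00, mul_one]))
  have e2 := hmem (c₂ • n₀) (Or.inr (by rw [inner_smul_right, h00, mul_one]))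
  have e3 := hmem (c₁ • n₀ + quarterTurn n₀)
    (Or.inl (by rw [inner_add_right, inner_smul_right, h00, hJ, mul_one, add_zero]))
  rw [inner_add_right, e1] at e3
  rw [inner_smul_right] at e1 e2
  have e4 : (c₂ - c₁) * inner ℝ n n₀ = 0 := by linarith
  have e5 := (mul_eq_zero.1 e4).resolve_left (sub_pos.2 hc).ne'
  have e6 := eq_of_orthogonal_frame hn₀0 e5 (by linarith)
  rw [e6, norm_zero] at hn
  exact zero_ne_one hn

lemma conformalField_zero (x : Space 2) : conformalField 0 0 0 x = 0 := by
  simp [conformalField]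

lemma freeExponent_halfPlane (c α β γ x₀ l₁ l₂ : ℝ) (n τ y v : Space 2) :
    freeExponent c α β γ 0 (-(β / 2 * x₀) • n + l₂ • τ) (-(α * x₀) • n + l₁ • τ) y v =
      c + (-α * inner ℝ (y - (2 * x₀) • n) y + β * inner ℝ (y - x₀ • n) v - γ * ‖v‖ ^ 2
        - 2 * l₁ * inner ℝ τ y + 2 * l₂ * inner ℝ τ v) := by
  simp only [freeExponent, inner_sub_left, inner_add_left, inner_smul_left, conj_trivial,
    real_inner_self_eq_norm_sq]
  ring

lemma freeExponent_radial (c γ w t : ℝ) (x y v : Space 2) :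
    freeExponent c 0 0 γ w (-(w • quarterTurn y)) 0 (x - t • v) v =
      c + (-γ * ‖v‖ ^ 2 + 2 * inner ℝ (w • quarterTurn (x - y)) v) := by
  simp only [freeExponent, inner_eq_coord, norm_sq_eq_coord, PiLp.sub_apply, PiLp.neg_apply,
    PiLp.smul_apply, PiLp.zero_apply, quarterTurn_zero_coord, quarterTurn_one_coord, smul_eq_mul]
  ring

lemma toEuclideanLin_skew {Λ : Matrix (Fin 2) (Fin 2) ℝ} (h : Λ.transpose = -Λ) (x : Space 2) :
    Matrix.toEuclideanLin Λ x = Λ 1 0 • quarterTurn x := by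
  have h00 := congrFun (congrFun h 0) 0
  have h01 := congrFun (congrFun h 1) 0
  have h11 := congrFun (congrFun h 1) 1
  simp only [Matrix.transpose_apply, Matrix.neg_apply] at h00 h01 h11
  have e00 : Λ 0 0 = 0 := by linarith
  have e11 : Λ 1 1 = 0 := by linarith
  ext i; fin_cases i
  · simp [Matrix.toLpLin_apply, e00, h01]
  · simp [Matrix.toLpLin_apply, e11]

/-! ### The four families of domains -/

theorem mainTheorem4 (T : EReal) (hT : 0 < T) (Ω : Set (Space 2)) (hΩ_open : IsOpen Ω)
    (hΩ_conn : IsConnected Ω) (hΩ_reg : HasRegularBoundary Ω)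
    (m : ℝ → Space 2 → Space 2 → ℝ) :
    -- half-plane
    (IsHalfPlane Ω →
      ∀ (x₀ : ℝ) (n τ : Space 2), ‖n‖ = 1 → ‖τ‖ = 1 → inner ℝ n τ = 0 →
        frontier Ω = lineAt x₀ n τ →
        (IsSpecularMaxwellian T Ω m ↔
          ∃ r₀ α β γ l₁ l₂ : ℝ, 0 < r₀ ∧ 0 < γ ∧
            (∀ t ∈ timeInterval T, 0 < α * t ^ 2 + β * t + γ) ∧
            ∀ t ∈ timeInterval T, ∀ x ∈ closure Ω, ∀ v : Space 2,
              m t x v = r₀ * Real.exp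
                (-α * inner ℝ (x - t • v - (2 * x₀) • n) (x - t • v)
                  + β * inner ℝ (x - t • v - x₀ • n) v - γ * ‖v‖ ^ 2
                  - 2 * l₁ * inner ℝ τ (x - t • v) + 2 * l₂ * inner ℝ τ v))) ∧
    -- slab
    (IsSlab Ω →
      ∀ (x₁ x₂ : ℝ) (n τ : Space 2), ‖n‖ = 1 → ‖τ‖ = 1 → inner ℝ n τ = 0 →
        frontier Ω = lineAt x₁ n τ ∪ lineAt x₂ n τ →
        (IsSpecularMaxwellian T Ω m ↔
          ∃ r₀ γ l₁ l₂ : ℝ, 0 < r₀ ∧ 0 < γ ∧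
            ∀ t ∈ timeInterval T, ∀ x ∈ closure Ω, ∀ v : Space 2,
              m t x v = r₀ * Real.exp
                (-γ * ‖v‖ ^ 2 - 2 * l₁ * inner ℝ τ (x - t • v) + 2 * l₂ * inner ℝ τ v))) ∧
    -- disk, complement of a disk, annulus
    (∀ y : Space 2, IsDisk Ω y ∨ IsDiskComplement Ω y ∨ IsAnnulus Ω y →
        (IsSpecularMaxwellian T Ω m ↔
          ∃ (r₀ γ : ℝ) (Λ₀ : Matrix (Fin 2) (Fin 2) ℝ), 0 < r₀ ∧ 0 < γ ∧ Λ₀.transpose = -Λ₀ ∧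
            ∀ t ∈ timeInterval T, ∀ x ∈ closure Ω, ∀ v : Space 2,
              m t x v = r₀ * Real.exp
                (-γ * ‖v‖ ^ 2 + 2 * inner ℝ (Matrix.toEuclideanLin Λ₀ (x - y)) v))) ∧
    -- every other domain
    (¬ IsHalfPlane Ω → ¬ IsSlab Ω →
      (∀ y : Space 2, ¬ IsDisk Ω y ∧ ¬ IsDiskComplement Ω y ∧ ¬ IsAnnulus Ω y) →
        (IsSpecularMaxwellian T Ω m ↔
          ∃ r₀ γ : ℝ, 0 < r₀ ∧ 0 < γ ∧
            ∀ t ∈ timeInterval T, ∀ x ∈ closure Ω, ∀ v : Space 2,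
              m t x v = r₀ * Real.exp (-γ * ‖v‖ ^ 2))) := by
  refine ⟨?_, ?_, ?_, ?_⟩
  · intro _ x₀ n τ hn hτ hnτ hfr
    have htan : ∀ l w p, IsTangentField Ω (conformalField l w p) ↔
        w = 0 ∧ inner ℝ n p = -(l * x₀) := fun l w p => by
      rw [← line_tangent_iff hΩ_reg hn hτ hnτ hfr.ge l w p, ← hfr]
      rfl
    constructor
    · intro hm
      obtain ⟨c, α, β, γ, w, p, q, hpos, hform, hq, hp⟩ := exists_freeExponent hT hΩ_open hΩ_conn hm
      obtain ⟨-, hq'⟩ := (htan _ _ _).1 hq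
      obtain ⟨rfl, hp'⟩ := (htan _ _ _).1 hp
      refine ⟨Real.exp c, α, β, γ, inner ℝ τ q, inner ℝ τ p, Real.exp_pos c, ?_, hpos, ?_⟩
      · simpa using hpos 0 (zero_mem_timeInterval hT)
      · intro t ht x hx v
        rw [hform t ht x hx, ← Real.exp_add, ← freeExponent_halfPlane, ← hq', ← hp',
          ← eq_of_inner_frame hn hτ hnτ, ← eq_of_inner_frame hn hτ hnτ]
    · rintro ⟨r₀, α, β, γ, l₁, l₂, hr₀, -, hpos, hform⟩
      refine isSpecularMaxwellian_of_freeExponent (c := Real.log r₀) (w := 0)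
        (p := -(β / 2 * x₀) • n + l₂ • τ) (q := -(α * x₀) • n + l₁ • τ) hΩ_open hpos ?_
        ((htan _ _ _).2 ⟨rfl, ?_⟩) ((htan _ _ _).2 ⟨rfl, ?_⟩)
      · intro t ht x hx v
        rw [hform t ht x hx, freeExponent_halfPlane, Real.exp_add (Real.log r₀), Real.exp_log hr₀]
      all_goals
        rw [inner_add_right, inner_smul_right, inner_smul_right, hnτ,
          real_inner_self_eq_norm_sq, hn]
        ring
  · intro hslab x₁ x₂ n τ hn hτ hnτ hfr
    have hne := hslab.line_ne hn hnτ hfr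
    have htan : ∀ l w p, IsTangentField Ω (conformalField l w p) ↔
        l = 0 ∧ w = 0 ∧ inner ℝ n p = 0 := fun l w p => by
      have h1 := line_tangent_iff hΩ_reg hn hτ hnτ (subset_union_left.trans hfr.ge) l w p
      have h2 := line_tangent_iff hΩ_reg hn hτ hnτ (subset_union_right.trans hfr.ge) l w p
      constructor
      · intro h
        obtain ⟨hw, e1⟩ := h1.1 fun x hx => h x (hfr ▸ Or.inl hx)
        obtain ⟨-, e2⟩ := h2.1 fun x hx => h x (hfr ▸ Or.inr hx)
        have e3 : l * (x₁ - x₂) = 0 := by linarith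
        have hl := (mul_eq_zero.1 e3).resolve_right (sub_ne_zero.2 hne)
        exact ⟨hl, hw, by rw [e1, hl]; ring⟩
      · rintro ⟨rfl, rfl, hp⟩ x hx
        rw [hfr] at hx
        rcases hx with hx | hx
        · exact h1.2 ⟨rfl, by rw [hp]; ring⟩ x hx
        · exact h2.2 ⟨rfl, by rw [hp]; ring⟩ x hx
    have hexp : ∀ (c γ l₁ l₂ : ℝ) (y v : Space 2), freeExponent c 0 0 γ 0 (l₂ • τ) (l₁ • τ) y v =
        c + (-γ * ‖v‖ ^ 2 - 2 * l₁ * inner ℝ τ y + 2 * l₂ * inner ℝ τ v) := fun c γ l₁ l₂ y v => by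
      simp only [freeExponent, inner_smul_left, conj_trivial]
      ring
    constructor
    · intro hm
      obtain ⟨c, α, β, γ, w, p, q, hpos, hform, hq, hp⟩ := exists_freeExponent hT hΩ_open hΩ_conn hm
      obtain ⟨rfl, -, hq'⟩ := (htan _ _ _).1 hq
      obtain ⟨hβ, rfl, hp'⟩ := (htan _ _ _).1 hp
      obtain rfl : β = 0 := by linarith
      have eq := eq_of_inner_frame hn hτ hnτ q
      have ep := eq_of_inner_frame hn hτ hnτ p
      rw [hq', zero_smul, zero_add] at eq
      rw [hp', zero_smul, zero_add] at ep
      refine ⟨Real.exp c, γ, inner ℝ τ q, inner ℝ τ p, Real.exp_pos c, ?_, ?_⟩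
      · simpa using hpos 0 (zero_mem_timeInterval hT)
      · intro t ht x hx v
        rw [hform t ht x hx, ← Real.exp_add, ← hexp, ← eq, ← ep]
    · rintro ⟨r₀, γ, l₁, l₂, hr₀, hγ, hform⟩
      refine isSpecularMaxwellian_of_freeExponent (c := Real.log r₀) (α := 0) (β := 0) (γ := γ)
        (w := 0) (p := l₂ • τ) (q := l₁ • τ) hΩ_open (fun t _ => by simpa using hγ) ?_
        ((htan _ _ _).2 ⟨rfl, rfl, ?_⟩) ((htan _ _ _).2 ⟨by simp, rfl, ?_⟩)
      · intro t ht x hx v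
        rw [hform t ht x hx, hexp, Real.exp_add (Real.log r₀), Real.exp_log hr₀]
      all_goals rw [inner_smul_right, hnτ, mul_zero]
  · intro y hy
    obtain ⟨hsat, hyf⟩ := saturated_and_center_notMem_frontier hy
    have htan := radial_tangent_iff hΩ_open hΩ_reg hsat hyf
    constructor
    · intro hm
      obtain ⟨c, α, β, γ, w, p, q, hpos, hform, hq, hp⟩ := exists_freeExponent hT hΩ_open hΩ_conn hm
      obtain ⟨rfl, hq'⟩ := (htan _ _ _).1 hq
      obtain ⟨hβ, rfl⟩ := (htan _ _ _).1 hp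
      obtain rfl : β = 0 := by linarith
      obtain rfl : q = 0 := by simpa using hq'
      have hskew : (!![0, -w; w, 0] : Matrix (Fin 2) (Fin 2) ℝ).transpose = -!![0, -w; w, 0] := by
        ext i j; fin_cases i <;> fin_cases j <;> simp
      refine ⟨Real.exp c, γ, !![0, -w; w, 0], Real.exp_pos c, ?_, hskew, ?_⟩
      · simpa using hpos 0 (zero_mem_timeInterval hT)
      · intro t ht x hx v
        rw [hform t ht x hx, ← Real.exp_add, toEuclideanLin_skew hskew, freeExponent_radial]
        simp
    · rintro ⟨r₀, γ, Λ₀, hr₀, hγ, hskew, hform⟩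
      refine isSpecularMaxwellian_of_freeExponent (c := Real.log r₀) (α := 0) (β := 0) (γ := γ)
        (w := Λ₀ 1 0) (p := -(Λ₀ 1 0 • quarterTurn y)) (q := 0) hΩ_open
        (fun t _ => by simpa using hγ) ?_
        ((htan _ _ _).2 ⟨rfl, by simp⟩) ((htan _ _ _).2 ⟨by simp, rfl⟩)
      intro t ht x hx v
      rw [hform t ht x hx, freeExponent_radial, Real.exp_add (Real.log r₀), Real.exp_log hr₀,
        toEuclideanLin_skew hskew]
  · intro hhp hslab hrad
    have hzero : ∀ l w p, IsTangentField Ω (conformalField l w p) → l = 0 ∧ w = 0 ∧ p = 0 := by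
      intro l w p hV
      by_contra hne
      rcases special_domain_of_isTangentField hΩ_open hΩ_conn hΩ_reg hV hne with h | h | ⟨y, h⟩
      · exact hhp h
      · exact hslab h
      · obtain ⟨h1, h2, h3⟩ := hrad y
        rcases h with h | h | h
        exacts [h1 h, h2 h, h3 h]
    have hexp : ∀ (c γ : ℝ) (y v : Space 2), freeExponent c 0 0 γ 0 0 0 y v =
        c + -γ * ‖v‖ ^ 2 := fun c γ y v => by
      simp only [freeExponent, inner_zero_left]
      ring
    constructor
    · intro hm
      obtain ⟨c, α, β, γ, w, p, q, hpos, hform, hq, hp⟩ := exists_freeExponent hT hΩ_open hΩ_conn hm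
      obtain ⟨rfl, -, rfl⟩ := hzero _ _ _ hq
      obtain ⟨hβ, rfl, rfl⟩ := hzero _ _ _ hp
      obtain rfl : β = 0 := by linarith
      refine ⟨Real.exp c, γ, Real.exp_pos c, ?_, ?_⟩
      · simpa using hpos 0 (zero_mem_timeInterval hT)
      · intro t ht x hx v
        rw [hform t ht x hx, ← Real.exp_add, hexp]
    · rintro ⟨r₀, γ, hr₀, hγ, hform⟩
      have h0 : IsTangentField Ω (conformalField 0 0 0) := fun x _ n _ => by
        rw [conformalField_zero, inner_zero_right]
      refine isSpecularMaxwellian_of_freeExponent (c := Real.log r₀) (α := 0) (β := 0) (γ := γ)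
        (w := 0) (p := 0) (q := 0) hΩ_open (fun t _ => by simpa using hγ) ?_ h0
        (by simpa using h0)
      intro t ht x hx v
      rw [hform t ht x hx, hexp, Real.exp_add (Real.log r₀), Real.exp_log hr₀]
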